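/- **Setting.** Let $R=\mathbb{C}[z]$, let $\sigma^{1/2}$ be the $\mathbb{C}$-algebra automorphism of $R$ with $\sigma^{1/2}(z)=z-\tfrac12$, and $\sigma=(\sigma^{1/2})^2$. For a nonzero polynomial $t\in R$ let $A(t)$ be the rank one (twisted) generalized Weyl algebra generated over $R$ by $X^+,X^-$ with relations $X^{\pm}r=\sigma^{\pm1}(r)X^{\pm}$ ($r\in R$) and $X^{\pm}X^{\mp}=\sigma^{\pm1/2}(t)$. Let $\mathcal{O}=\{(z-n)\mid n\in\mathbb{Z}\}\subset \mathrm{MaxSpec}(R)$, and let $A(t)\text{-wmod}_{\mathcal O}$ be the category of $A(t)$-modules $M$ such that $M=\bigoplus_{\mathfrak m}M_{\mathfrak m}$, $M_{\mathfrak m}=\{v\mid \mathfrak m v=0\}$, with all $M_{\mathfrak m}$ finite-dimensional over $R/\mathfrak m$ and $M_{\mathfrak m}=0$ for $\mathfrak m\notin\mathcal O$. Let $K_0(A(t)\text{-wmod}_{\mathcal O})$ be its Grothendieck group (relations $[N]=[M]+[Q]$ for short exact sequences $0\to M\to N\to Q\to0$) and $K_0^{\mathrm{split}}(A(t)\text{-wmod}_{\mathcal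 O})$ its split Grothendieck group (relations $[M\oplus Q]=[M]+[Q]$ only). For a multiplicative monoid $\Gamma\subset R\setminus\{0\}$ put $$\mathscr A(\Gamma,\mathcal O)=\bigoplus_{t\in\Gamma}\mathbb{C}\otimes_{\mathbb Z}K_0(A(t)\text{-wmod}_{\mathcal O}),\qquad \mathscr A^{\mathrm{split}}(\Gamma,\mathcal O)=\bigoplus_{t\in\Gamma}\mathbb{C}\otimes_{\mathbb Z}K_0^{\mathrm{split}}(A(t)\text{-wmod}_{\mathcal O}),$$ with product $[M][M']=[M\otimes_RM']$, where for $M$ over $A(t)$ and $M'$ over $A(t')$ the $R$-module $M\otimes_RM'$ is an $A(tt')$-module through $X^{\pm}(v\otimes v')=X^{\pm}v\otimes X^{\pm}v'$. These are commutative unital $\mathbb{C}$-algebras; the identity is $[M^1]$, where $M^1$ is the $A(1)$-module with basis $v_j$ ($j\in\mathbb Z$), $zv_j=jv_j$, $X^\pm v_j=v_{j\pm1}$. For $k\in\mathbb{Z}+\tfrac12$ consider the following $A(z-k)$-modules with basis $v_j$ ($j$ in the indicated set of integers) and $zv_j=jv_j$, where $v_i=0$ for indices $i$ outside the set: * $M_{(k,\infty)}$,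 $j>k$, and $M_{\mathbb{R}_k^+}$, all $j\in\mathbb Z$: $X^+v_j=v_{j+1}$, $X^-v_j=(j-\tfrac12-k)v_{j-1}$; * $M_{(-\infty,k)}$, $j<k$, and $M_{\mathbb{R}_k^-}$, all $j\in\mathbb Z$: $X^+v_j=(j+\tfrac12-k)v_{j+1}$, $X^-v_j=v_{j-1}$. When $z-k\in\Gamma$, write $x_k^+=[M_{(k,\infty)}]$ and $x_k^-=[M_{(-\infty,k)}]$ (in either algebra) and $y_k^\pm=[M_{\mathbb{R}_k^\pm}]\in\mathscr A^{\mathrm{split}}(\Gamma,\mathcal O)$. **Theorem (split to non-split map).** Let $Z$ be any subset of $\mathbb{Z}+\tfrac12$ and let $\Gamma$ be the monoid of all monic polynomials in $\mathbb{C}[z]$ whose zero set is contained in $Z$. Then the canonical linear map $\mathscr A^{\mathrm{split}}(\Gamma,\mathcal O)\to\mathscr A(\Gamma,\mathcal O)$ induced by the maps $K_0^{\mathrm{split}}(A(t)\text{-wmod}_{\mathcal O})\to K_0(A(t)\text{-wmod}_{\mathcal O})$, $[M]\mapsto[M]$, $t\in\Gamma$, is a surjective homomorphism of unital $\mathbb{C}$-algebras,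 and for all $k\in Z$ it satisfies $$x_k^+\mapsto x_k^+,\qquad x_k^-\mapsto x_k^-,\qquad y_k^+\mapsto x_k^++x_k^-,\qquad y_k^-\mapsto x_k^++x_k^-.$$ -/

import Mathlib

open scoped Polynomial TensorProduct DirectSum

namespace WeylTower

noncomputable section

/-- `σ^{1/2}`, the automorphism `z ↦ z - 1/2` of `ℂ[z]`. -/
def halfShift : ℂ[X] ≃ₐ[ℂ] ℂ[X] := Polynomial.algEquivAevalXAddC (-(1 / 2 : ℂ))

/-- `σ`, the square of `σ^{1/2}`, that is `z ↦ z - 1`. -/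
def shift : ℂ[X] ≃ₐ[ℂ] ℂ[X] := halfShift.trans halfShift

/-- `σ` as a ring homomorphism. -/
def shiftUp : ℂ[X] →+* ℂ[X] := (shift : ℂ[X] →ₐ[ℂ] ℂ[X])

/-- `σ⁻¹` as a ring homomorphism. -/
def shiftDown : ℂ[X] →+* ℂ[X] := (shift.symm : ℂ[X] →ₐ[ℂ] ℂ[X])

/-- The names of the generators `z`, `X⁺`, `X⁻`. -/
inductive Gen
  | z
  | up
  | down

/-- The polynomial `r(z)` in the free algebra on `z`, `X⁺`, `X⁻`. -/
def freeCoeff : ℂ[X] →ₐ[ℂ] FreeAlgebra ℂ Gen :=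
  Polynomial.aeval (FreeAlgebra.ι ℂ Gen.z)

/-- The defining relations of the rank one twisted generalized Weyl algebra `A(t)`:
`X^± r = σ^{±1}(r) X^±` and `X^± X^∓ = σ^{±1/2}(t)`. -/
inductive Rel (t : ℂ[X]) : FreeAlgebra ℂ Gen → FreeAlgebra ℂ Gen → Prop
  | up_coeff (r : ℂ[X]) :
      Rel t (FreeAlgebra.ι ℂ Gen.up * freeCoeff r)
        (freeCoeff (shift r) * FreeAlgebra.ι ℂ Gen.up)
  | down_coeff (r : ℂ[X]) :
      Rel t (FreeAlgebra.ι ℂ Gen.down * freeCoeff r)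
        (freeCoeff (shift.symm r) * FreeAlgebra.ι ℂ Gen.down)
  | up_down :
      Rel t (FreeAlgebra.ι ℂ Gen.up * FreeAlgebra.ι ℂ Gen.down) (freeCoeff (halfShift t))
  | down_up :
      Rel t (FreeAlgebra.ι ℂ Gen.down * FreeAlgebra.ι ℂ Gen.up) (freeCoeff (halfShift.symm t))

/-- The algebra `A(t)` over `R = ℂ[z]`, generated by `R`, `X⁺`, `X⁻` with the relations above.
In rank one, for `t ≠ 0`, it is free over `R` with basis the powers of `X⁺` and `X⁻`, so the ideal
of `R`-torsion elements divided out in the general definition is zero. -/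
def A (t : ℂ[X]) : Type := RingQuot (Rel t)

instance (t : ℂ[X]) : Ring (A t) := inferInstanceAs (Ring (RingQuot (Rel t)))

instance (t : ℂ[X]) : Algebra ℂ (A t) := inferInstanceAs (Algebra ℂ (RingQuot (Rel t)))

/-- The projection from the free algebra. -/
def proj (t : ℂ[X]) : FreeAlgebra ℂ Gen →ₐ[ℂ] A t := RingQuot.mkAlgHom ℂ (Rel t)

theorem proj_rel {t : ℂ[X]} {x y : FreeAlgebra ℂ Gen} (h : Rel t x y) : proj t x = proj t y :=
  RingQuot.mkAlgHom_rel ℂ h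

/-- The canonical map `R → A(t)`. -/
def coeff (t : ℂ[X]) : ℂ[X] →ₐ[ℂ] A t := (proj t).comp freeCoeff

/-- The generator `X⁺(t)`. -/
def Xup (t : ℂ[X]) : A t := proj t (FreeAlgebra.ι ℂ Gen.up)

/-- The generator `X⁻(t)`. -/
def Xdown (t : ℂ[X]) : A t := proj t (FreeAlgebra.ι ℂ Gen.down)

theorem proj_surjective (t : ℂ[X]) : Function.Surjective (proj t) :=
  RingQuot.mkAlgHom_surjective ℂ (Rel t)

theorem Xup_coeff (t r : ℂ[X]) : Xup t * coeff t r = coeff t (shift r) * Xup t := by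
  have := proj_rel (Rel.up_coeff (t := t) r)
  rwa [map_mul, map_mul] at this

theorem Xdown_coeff (t r : ℂ[X]) : Xdown t * coeff t r = coeff t (shift.symm r) * Xdown t := by
  have := proj_rel (Rel.down_coeff (t := t) r)
  rwa [map_mul, map_mul] at this

theorem Xup_Xdown (t : ℂ[X]) : Xup t * Xdown t = coeff t (halfShift t) := by
  have := proj_rel (Rel.up_down (t := t))
  rwa [map_mul] at this

theorem Xdown_Xup (t : ℂ[X]) : Xdown t * Xup t = coeff t (halfShift.symm t) := by
  have := proj_rel (Rel.down_up (t := t))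
  rwa [map_mul] at this

/-- Induction principle: `A(t)` is generated by `R`, `X⁺` and `X⁻`. -/
theorem A_induction {t : ℂ[X]} {p : A t → Prop} (hr : ∀ r, p (coeff t r)) (hu : p (Xup t))
    (hd : p (Xdown t)) (hadd : ∀ a b, p a → p b → p (a + b))
    (hmul : ∀ a b, p a → p b → p (a * b)) (a : A t) : p a := by
  obtain ⟨x, rfl⟩ := proj_surjective t a
  induction x using FreeAlgebra.induction with
  | grade0 c =>
    have := hr (Polynomial.C c)
    simpa [coeff, freeCoeff] using this
  | grade1 g =>
    cases g with
    | z => simpa [coeff, freeCoeff] using hr Polynomial.X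
    | up => exact hu
    | down => exact hd
  | mul a b ha hb => rw [map_mul]; exact hmul _ _ ha hb
  | add a b ha hb => rw [map_add]; exact hadd _ _ ha hb

/-- An `R`-module with operators satisfying the defining relations carries an action of `A(t)`. -/
theorem exists_action (t : ℂ[X]) {V : Type} [AddCommGroup V] [Module ℂ[X] V]
    (P : V →ₛₗ[shiftUp] V) (N : V →ₛₗ[shiftDown] V)
    (hPN : ∀ v, P (N v) = halfShift t • v) (hNP : ∀ v, N (P v) = halfShift.symm t • v) :
    ∃ f : A t →+* AddMonoid.End V, (∀ r v, f (coeff t r) v = r • v) ∧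
      (∀ v, f (Xup t) v = P v) ∧ (∀ v, f (Xdown t) v = N v) := by
  let : Module ℂ V := Module.compHom V (Polynomial.C : ℂ →+* ℂ[X])
  have : IsScalarTower ℂ ℂ[X] V := ⟨fun c r v => by
    rw [Polynomial.smul_eq_C_mul, mul_smul]; rfl⟩
  let P' : Module.End ℂ V :=
    { toFun := P, map_add' := map_add P, map_smul' := fun c v => by
        change P (Polynomial.C c • v) = Polynomial.C c • P v
        rw [map_smulₛₗ]; congr 1
        exact shift.commutes c }
  let N' : Module.End ℂ V :=
    { toFun := N, map_add' := map_add N, map_smul' := fun c v => by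
        change N (Polynomial.C c • v) = Polynomial.C c • N v
        rw [map_smulₛₗ]; congr 1
        exact shift.symm.commutes c }
  let F : FreeAlgebra ℂ Gen →ₐ[ℂ] Module.End ℂ V :=
    FreeAlgebra.lift ℂ (fun g => match g with
      | Gen.z => Algebra.lsmul ℂ ℂ V (Polynomial.X : ℂ[X])
      | Gen.up => P'
      | Gen.down => N')
  have hF : ∀ r : ℂ[X], F (freeCoeff r) = Algebra.lsmul ℂ ℂ V r := by
    intro r
    have : F.comp freeCoeff = Algebra.lsmul ℂ ℂ V := by
      apply Polynomial.algHom_ext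
      simp [freeCoeff, F]
    exact DFunLike.congr_fun this r
  have hu : F (FreeAlgebra.ι ℂ Gen.up) = P' := by simp [F]
  have hd : F (FreeAlgebra.ι ℂ Gen.down) = N' := by simp [F]
  let G : A t →ₐ[ℂ] Module.End ℂ V := RingQuot.liftAlgHom ℂ ⟨F, by
    intro x y h
    cases h with
    | up_coeff r =>
      rw [map_mul, map_mul, hF, hF, hu]
      ext v
      exact map_smulₛₗ P r v
    | down_coeff r =>
      rw [map_mul, map_mul, hF, hF, hd]
      ext v
      exact map_smulₛₗ N r v
    | up_down =>
      rw [map_mul, hF, hu, hd]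
      ext v
      exact hPN v
    | down_up =>
      rw [map_mul, hF, hu, hd]
      ext v
      exact hNP v⟩
  have hG : ∀ x, G (proj t x) = F x := fun x => RingQuot.liftAlgHom_mkAlgHom_apply ℂ _ _ x
  refine ⟨(Module.toAddMonoidEnd (Module.End ℂ V) V).comp (G : A t →+* Module.End ℂ V),
    fun r v => ?_, fun v => ?_, fun v => ?_⟩
  · change G (proj t (freeCoeff r)) v = _
    rw [hG, hF]; rfl
  · change G (proj t _) v = _
    rw [hG, hu]; rfl
  · change G (proj t _) v = _
    rw [hG, hd]; rfl

/-- The action of `A(t)` on an `R`-module `V` determined by the operators `P` (for `X⁺`)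
and `N` (for `X⁻`). It is unique since `R`, `X⁺`, `X⁻` generate `A(t)`. -/
def actionHom (t : ℂ[X]) {V : Type} [AddCommGroup V] [Module ℂ[X] V]
    (P : V →ₛₗ[shiftUp] V) (N : V →ₛₗ[shiftDown] V)
    (hPN : ∀ v, P (N v) = halfShift t • v) (hNP : ∀ v, N (P v) = halfShift.symm t • v) :
    A t →+* AddMonoid.End V :=
  (exists_action t P N hPN hNP).choose

section action

variable {t : ℂ[X]} {V : Type} [AddCommGroup V] [Module ℂ[X] V]
  (P : V →ₛₗ[shiftUp] V) (N : V →ₛₗ[shiftDown] V)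
  (hPN : ∀ v, P (N v) = halfShift t • v) (hNP : ∀ v, N (P v) = halfShift.symm t • v)

theorem actionHom_coeff (r : ℂ[X]) (v : V) :
    actionHom t P N hPN hNP (coeff t r) v = r • v :=
  (exists_action t P N hPN hNP).choose_spec.1 r v

theorem actionHom_up (v : V) : actionHom t P N hPN hNP (Xup t) v = P v :=
  (exists_action t P N hPN hNP).choose_spec.2.1 v

theorem actionHom_down (v : V) : actionHom t P N hPN hNP (Xdown t) v = N v :=
  (exists_action t P N hPN hNP).choose_spec.2.2 v

end action

/-- The weight space `V_𝔪 = {v | 𝔪 v = 0}` for the maximal ideal `𝔪 = (z - μ)` of `R = ℂ[z]`;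
every maximal ideal of `R` has this form for a unique `μ ∈ ℂ`. -/
def weightSpace (V : Type) [AddCommGroup V] [Module ℂ[X] V] (μ : ℂ) : Submodule ℂ[X] V :=
  Submodule.torsionBy ℂ[X] V (Polynomial.X - Polynomial.C μ)

/-- `V` is the direct sum of its weight spaces, the weight spaces are finite-dimensional over
`R/𝔪` (equivalently finitely generated over `R`), and the support of `V` is contained in the
integral orbit `𝒪 = {(z - n) | n ∈ ℤ}`. -/
structure IsIntegralWeight (V : Type) [AddCommGroup V] [Module ℂ[X] V] : Prop where
  isInternal : DirectSum.IsInternal (weightSpace V)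
  fg : ∀ μ, (weightSpace V μ).FG
  support : ∀ μ, weightSpace V μ ≠ ⊥ → ∃ n : ℤ, μ = n

/-- An object of `A(t)-wmod_𝒪` for the integral orbit `𝒪`: an `A(t)`-module which, with the
`R`-module structure obtained by restriction along `R → A(t)`, is a weight module with
finite-dimensional weight spaces and support in `𝒪`. -/
structure WMod (t : ℂ[X]) where
  carrier : Type
  [addCommGroup : AddCommGroup carrier]
  [coeffModule : Module ℂ[X] carrier]
  [algModule : Module (A t) carrier]
  coeff_smul : ∀ (r : ℂ[X]) (v : carrier), coeff t r • v = r • v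
  isWeight : IsIntegralWeight carrier

attribute [instance] WMod.addCommGroup WMod.coeffModule WMod.algModule

instance (t : ℂ[X]) : CoeSort (WMod t) Type := ⟨WMod.carrier⟩

section weight

variable {V : Type} [AddCommGroup V] [Module ℂ[X] V]

theorem mem_weightSpace {μ : ℂ} {v : V} :
    v ∈ weightSpace V μ ↔ (Polynomial.X - Polynomial.C μ) • v = 0 :=
  Submodule.mem_torsionBy_iff _ _

theorem iSupIndep_weightSpace : iSupIndep (weightSpace V) := by
  classical
  rw [iSupIndep_iff_supIndep]
  intro S
  have h := Submodule.supIndep_torsionBySet_ideal (R := ℂ[X]) (M := V) (S := S)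
    (p := fun μ => Ideal.span {Polynomial.X - Polynomial.C μ}) (by
      intro i _ j _ hij
      rw [← Ideal.isCoprime_iff_sup_eq, Ideal.isCoprime_span_singleton_iff]
      exact Polynomial.isCoprime_X_sub_C_of_isUnit_sub (sub_ne_zero.2 hij).isUnit)
  have e : (fun μ => Submodule.torsionBySet ℂ[X] V
      (Ideal.span {Polynomial.X - Polynomial.C μ} : Ideal ℂ[X])) = weightSpace V := by
    funext μ
    exact Submodule.torsionBySet_span_singleton_eq _
  rwa [e] at h

theorem IsIntegralWeight.of_le (W : ℂ → Submodule ℂ[X] V) (hle : ∀ μ, W μ ≤ weightSpace V μ)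
    (htop : ⨆ μ, W μ = ⊤) (hfg : ∀ μ, (W μ).FG) (hsupp : ∀ μ, W μ ≠ ⊥ → ∃ n : ℤ, μ = n) :
    IsIntegralWeight V := by
  have hW : W = weightSpace V := by
    funext μ
    refine le_antisymm (hle μ) ?_
    have hd := iSupIndep_weightSpace (V := V) μ
    have h1 : W μ ⊔ ⨆ ν, ⨆ (_ : ν ≠ μ), weightSpace V ν = ⊤ := by
      rw [eq_top_iff, ← htop]
      refine iSup_le fun ν => ?_
      by_cases h : ν = μ
      · subst h; exact le_sup_left
      · exact le_sup_of_le_right ((hle ν).trans (le_iSup₂_of_le ν h le_rfl))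
    calc weightSpace V μ = (W μ ⊔ ⨆ ν, ⨆ (_ : ν ≠ μ), weightSpace V ν) ⊓ weightSpace V μ := by
          rw [h1, top_inf_eq]
      _ ≤ W μ ⊔ (⨆ ν, ⨆ (_ : ν ≠ μ), weightSpace V ν) ⊓ weightSpace V μ :=
          (sup_inf_assoc_of_le _ (hle μ)).le
      _ ≤ W μ := by rw [inf_comm, hd.eq_bot, sup_bot_eq]
  subst hW
  exact ⟨(DirectSum.isInternal_submodule_iff_iSupIndep_and_iSup_eq_top _).2
    ⟨iSupIndep_weightSpace, htop⟩, hfg, hsupp⟩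

theorem IsIntegralWeight.iSup_eq_top (h : IsIntegralWeight V) : ⨆ μ, weightSpace V μ = ⊤ :=
  h.isInternal.submodule_iSup_eq_top

theorem IsIntegralWeight.induction (h : IsIntegralWeight V) {p : V → Prop}
    (hw : ∀ μ, ∀ v ∈ weightSpace V μ, p v) (hadd : ∀ v w, p v → p w → p (v + w)) (v : V) : p v := by
  have hv : v ∈ ⨆ μ, weightSpace V μ := h.iSup_eq_top ▸ Submodule.mem_top
  exact Submodule.iSup_induction _ (motive := p) hv hw (hw 0 0 (Submodule.zero_mem _)) hadd

theorem smul_of_mem_weightSpace {μ : ℂ} {v : V}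
    (hv : v ∈ weightSpace V μ) (r : ℂ[X]) : r • v = Polynomial.C (r.eval μ) • v := by
  rw [mem_weightSpace] at hv
  obtain ⟨q, hq⟩ := Polynomial.X_sub_C_dvd_sub_C_eval (a := μ) (p := r)
  have : r = q * (Polynomial.X - Polynomial.C μ) + Polynomial.C (r.eval μ) := by
    rw [mul_comm, ← hq]; ring
  conv_lhs => rw [this]
  rw [add_smul, mul_smul, hv, smul_zero, zero_add]

/-- Weight modules are semisimple over `R`. -/
theorem IsIntegralWeight.isSemisimple (h : IsIntegralWeight V) : IsSemisimpleModule ℂ[X] V := by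
  apply IsSemisimpleModule.of_sSup_simples_eq_top
  rw [eq_top_iff]
  rintro v -
  refine h.induction (p := fun v => v ∈ sSup {m : Submodule ℂ[X] V | IsSimpleModule ℂ[X] m})
    (fun μ v hv => ?_) (fun v w => Submodule.add_mem _) v
  by_cases h0 : v = 0
  · subst h0; exact Submodule.zero_mem _
  · refine Submodule.mem_sSup_of_mem (s := Submodule.span ℂ[X] {v}) ?_
      (Submodule.mem_span_singleton_self v)
    have hsmul := smul_of_mem_weightSpace hv
    have hv' : (⟨v, Submodule.mem_span_singleton_self v⟩ : Submodule.span ℂ[X] {v}) ≠ 0 := by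
      intro h; exact h0 (congrArg Subtype.val h)
    have : Nontrivial (Submodule.span ℂ[X] {v}) := ⟨_, 0, hv'⟩
    refine isSimpleModule_iff_toSpanSingleton_surjective.2 ⟨this, ?_⟩
    rintro ⟨w, hw⟩ hw0 ⟨u, hu⟩
    obtain ⟨r, rfl⟩ := Submodule.mem_span_singleton.1 hw
    obtain ⟨s, rfl⟩ := Submodule.mem_span_singleton.1 hu
    have hr : r.eval μ ≠ 0 := by
      intro hr
      apply hw0
      ext
      change r • v = 0
      rw [hsmul, hr, map_zero, zero_smul]
    refine ⟨Polynomial.C ((r.eval μ)⁻¹) * s, ?_⟩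
    ext
    change (Polynomial.C ((r.eval μ)⁻¹) * s) • r • v = s • v
    rw [hsmul r, ← mul_smul, mul_right_comm, ← map_mul, inv_mul_cancel₀ hr, map_one, one_mul]

end weight

section stringModules

/-- The space with basis `v_j`, `j ∈ S`, where `z v_j = j v_j`. -/
def StringSpace (S : Set ℤ) : Type := S →₀ ℂ

instance (S : Set ℤ) : AddCommGroup (StringSpace S) := inferInstanceAs (AddCommGroup (S →₀ ℂ))

instance (S : Set ℤ) : Module ℂ[X] (StringSpace S) :=
  Module.compHom (S →₀ ℂ) (RingHom.pi fun j : S => Polynomial.evalRingHom ((j : ℤ) : ℂ))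

/-- The vector `c v_j`. -/
def StringSpace.single {S : Set ℤ} (j : S) (c : ℂ) : StringSpace S := Finsupp.single j c

/-- The additive map out of `StringSpace S` with given restrictions to the lines `ℂ v_j`. -/
def StringSpace.lift {S : Set ℤ} {B : Type} [AddCommGroup B] (f : S → ℂ →+ B) :
    StringSpace S →+ B := Finsupp.liftAddHom f

theorem StringSpace.lift_single {S : Set ℤ} {B : Type} [AddCommGroup B] (f : S → ℂ →+ B)
    (j : S) (c : ℂ) : StringSpace.lift f (StringSpace.single j c) = f j c :=
  Finsupp.liftAddHom_apply_single f j c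

theorem StringSpace.smul_single {S : Set ℤ} (r : ℂ[X]) (j : S) (c : ℂ) :
    r • StringSpace.single j c = StringSpace.single j (r.eval ((j : ℤ) : ℂ) * c) := by
  classical
  refine Finsupp.ext fun i => ?_
  change r.eval ((i : ℤ) : ℂ) * Finsupp.single j c i = Finsupp.single j _ i
  by_cases h : j = i
  · subst h; simp
  · simp [Finsupp.single_eq_of_ne' h]

theorem StringSpace.single_zero {S : Set ℤ} (j : S) : StringSpace.single j 0 = 0 :=
  Finsupp.single_zero j

theorem StringSpace.single_add {S : Set ℤ} (j : S) (c d : ℂ) :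
    StringSpace.single j (c + d) = StringSpace.single j c + StringSpace.single j d :=
  Finsupp.single_add j c d

/-- `c ↦ c v_j` as an additive map. -/
def StringSpace.singleHom {S : Set ℤ} (j : S) : ℂ →+ StringSpace S :=
  AddMonoidHom.mk' (StringSpace.single j) (StringSpace.single_add j)

theorem StringSpace.induction {S : Set ℤ} {p : StringSpace S → Prop}
    (h0 : p 0) (hs : ∀ j c, p (StringSpace.single j c))
    (hadd : ∀ v w, p v → p w → p (v + w)) (v : StringSpace S) : p v :=
  Finsupp.induction_linear v h0 (fun _ _ => hadd _ _) hs

theorem StringSpace.isIntegralWeight (S : Set ℤ) : IsIntegralWeight (StringSpace S) := by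
  refine IsIntegralWeight.of_le
    (fun μ => Submodule.span ℂ[X]
      ((fun j => StringSpace.single j 1) '' {j : S | ((j : ℤ) : ℂ) = μ})) ?_ ?_ ?_ ?_
  · intro μ
    rw [Submodule.span_le]
    rintro _ ⟨j, hj, rfl⟩
    have hj' : ((j : ℤ) : ℂ) = μ := hj
    rw [SetLike.mem_coe, mem_weightSpace, StringSpace.smul_single]
    simp [hj', StringSpace.single_zero]
  · rw [eq_top_iff]
    rintro v -
    refine StringSpace.induction (p := fun v => v ∈ ⨆ μ : ℂ, Submodule.span ℂ[X]
        ((fun j => StringSpace.single j (1 : ℂ)) '' {j : S | ((j : ℤ) : ℂ) = μ}))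
      (Submodule.zero_mem _) (fun j c => ?_) (fun v w => Submodule.add_mem _) v
    refine Submodule.mem_iSup_of_mem ((j : ℤ) : ℂ) ?_
    have : StringSpace.single j c = Polynomial.C c • StringSpace.single j 1 := by
      rw [StringSpace.smul_single]; simp
    rw [this]
    exact Submodule.smul_mem _ _ (Submodule.subset_span ⟨j, rfl, rfl⟩)
  · intro μ
    refine Submodule.fg_span (Set.Finite.image _ (Set.Subsingleton.finite ?_))
    intro i hi j hj
    have : ((i : ℤ) : ℂ) = ((j : ℤ) : ℂ) := Eq.trans hi (Eq.symm hj)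
    exact Subtype.ext (Int.cast_injective this)
  · intro μ h
    by_contra hμ
    apply h
    rw [Submodule.span_eq_bot]
    rintro _ ⟨j, hj, rfl⟩
    exact (hμ ⟨j, Eq.symm hj⟩).elim

open Classical in
/-- The additive map with `c v_j ↦ (a_j c) v_{j+d}`, where `v_{j+d} = 0` if `j + d ∉ S`. -/
def stepAddHom (S : Set ℤ) (d : ℤ) (a : ℤ → ℂ) : StringSpace S →+ StringSpace S :=
  StringSpace.lift fun j : S =>
    if h : (j : ℤ) + d ∈ S then
      (StringSpace.singleHom (⟨(j : ℤ) + d, h⟩ : S)).comp (AddMonoidHom.mulLeft (a j))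
    else 0

theorem stepAddHom_single_mem {S : Set ℤ} {d : ℤ} {a : ℤ → ℂ} {j : S} (h : (j : ℤ) + d ∈ S)
    (c : ℂ) : stepAddHom S d a (StringSpace.single j c) =
      StringSpace.single ⟨(j : ℤ) + d, h⟩ (a j * c) := by
  unfold stepAddHom
  rw [StringSpace.lift_single, dif_pos h]
  rfl

theorem stepAddHom_single_notMem {S : Set ℤ} {d : ℤ} {a : ℤ → ℂ} {j : S} (h : (j : ℤ) + d ∉ S)
    (c : ℂ) : stepAddHom S d a (StringSpace.single j c) = 0 := by
  unfold stepAddHom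
  rw [StringSpace.lift_single, dif_neg h]
  rfl

theorem halfShift_eval (r : ℂ[X]) (x : ℂ) : (halfShift r).eval x = r.eval (x - 1 / 2) := by
  change (Polynomial.aeval (Polynomial.X + Polynomial.C (-(1 / 2 : ℂ))) r).eval x = _
  rw [← Polynomial.comp_eq_aeval, Polynomial.eval_comp]
  simp [sub_eq_add_neg]

theorem halfShift_symm_eval (r : ℂ[X]) (x : ℂ) :
    (halfShift.symm r).eval x = r.eval (x + 1 / 2) := by
  have := halfShift_eval (halfShift.symm r) (x + 1 / 2)
  rw [AlgEquiv.apply_symm_apply] at this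
  rw [this]; congr 1; ring

theorem shift_eval (r : ℂ[X]) (x : ℂ) : (shift r).eval x = r.eval (x - 1) := by
  change (halfShift (halfShift r)).eval x = _
  rw [halfShift_eval, halfShift_eval]; congr 1; ring

theorem shift_symm_eval (r : ℂ[X]) (x : ℂ) : (shift.symm r).eval x = r.eval (x + 1) := by
  have := shift_eval (shift.symm r) (x + 1)
  rw [AlgEquiv.apply_symm_apply] at this
  rw [this]; congr 1; ring

/-- `v_j ↦ a_j v_{j+1}` -/
def stepUp (S : Set ℤ) (a : ℤ → ℂ) : StringSpace S →ₛₗ[shiftUp] StringSpace S :=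
  { stepAddHom S 1 a with
    map_smul' := fun r v => by
      change stepAddHom S 1 a (r • v) = shift r • stepAddHom S 1 a v
      induction v using StringSpace.induction with | h0 => ?_ | hs j c => ?_ | hadd v w hv hw => ?_
      · simp only [smul_zero, map_zero]
      · rw [StringSpace.smul_single]
        by_cases h : (j : ℤ) + 1 ∈ S
        · rw [stepAddHom_single_mem h, stepAddHom_single_mem h, StringSpace.smul_single,
            shift_eval]
          congr 1
          push_cast
          rw [add_sub_cancel_right]; ring
        · rw [stepAddHom_single_notMem h, stepAddHom_single_notMem h, smul_zero]
      · rw [smul_add, map_add, hv, hw, map_add, smul_add] }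

/-- `v_j ↦ b_j v_{j-1}` -/
def stepDown (S : Set ℤ) (b : ℤ → ℂ) : StringSpace S →ₛₗ[shiftDown] StringSpace S :=
  { stepAddHom S (-1) b with
    map_smul' := fun r v => by
      change stepAddHom S (-1) b (r • v) = shift.symm r • stepAddHom S (-1) b v
      induction v using StringSpace.induction with | h0 => ?_ | hs j c => ?_ | hadd v w hv hw => ?_
      · simp only [smul_zero, map_zero]
      · rw [StringSpace.smul_single]
        by_cases h : (j : ℤ) + (-1) ∈ S
        · rw [stepAddHom_single_mem h, stepAddHom_single_mem h, StringSpace.smul_single,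
            shift_symm_eval]
          congr 1
          push_cast
          rw [neg_add_cancel_right]; ring
        · rw [stepAddHom_single_notMem h, stepAddHom_single_notMem h, smul_zero]
      · rw [smul_add, map_add, hv, hw, map_add, smul_add] }

theorem stepUp_single_mem {S : Set ℤ} {a : ℤ → ℂ} {j : S} (h : (j : ℤ) + 1 ∈ S) (c : ℂ) :
    stepUp S a (StringSpace.single j c) = StringSpace.single ⟨(j : ℤ) + 1, h⟩ (a j * c) :=
  stepAddHom_single_mem h c

theorem stepUp_single_notMem {S : Set ℤ} {a : ℤ → ℂ} {j : S} (h : (j : ℤ) + 1 ∉ S) (c : ℂ) :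
    stepUp S a (StringSpace.single j c) = 0 :=
  stepAddHom_single_notMem h c

theorem stepDown_single_mem {S : Set ℤ} {b : ℤ → ℂ} {j : S} (h : (j : ℤ) + (-1) ∈ S) (c : ℂ) :
    stepDown S b (StringSpace.single j c) = StringSpace.single ⟨(j : ℤ) + (-1), h⟩ (b j * c) :=
  stepAddHom_single_mem h c

theorem stepDown_single_notMem {S : Set ℤ} {b : ℤ → ℂ} {j : S} (h : (j : ℤ) + (-1) ∉ S) (c : ℂ) :
    stepDown S b (StringSpace.single j c) = 0 :=
  stepAddHom_single_notMem h c

/-- The weight module with basis `v_j`, `j ∈ S`, with `X⁺ v_j = a_j v_{j+1}` and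
`X⁻ v_j = b_j v_{j-1}`, where `v_i` means `0` if `i ∉ S`. The hypotheses say that the relations
`X⁻ X⁺ = σ^{-1/2}(t)` and `X⁺ X⁻ = σ^{1/2}(t)` hold on the basis. -/
def stringModule (t : ℂ[X]) (S : Set ℤ) (a b : ℤ → ℂ)
    (hin : ∀ j, j ∈ S → j + 1 ∈ S → a j * b (j + 1) = t.eval ((j : ℂ) + 1 / 2))
    (hout : ∀ j, (j ∈ S ∧ j + 1 ∉ S ∨ j ∉ S ∧ j + 1 ∈ S) → t.eval ((j : ℂ) + 1 / 2) = 0) :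
    WMod t :=
  letI f := actionHom t (stepUp S a) (stepDown S b)
    (fun v => by
      induction v using StringSpace.induction with | h0 => ?_ | hs j c => ?_ | hadd v w hv hw => ?_
      · simp only [smul_zero, map_zero]
      · rw [StringSpace.smul_single, halfShift_eval]
        have e : (((j : ℤ) + (-1) : ℤ) : ℂ) + 1 / 2 = ((j : ℤ) : ℂ) - 1 / 2 := by
          push_cast; ring
        by_cases h : (j : ℤ) + (-1) ∈ S
        · have h' : ((⟨(j : ℤ) + (-1), h⟩ : S) : ℤ) + 1 ∈ S := by simp
          rw [stepDown_single_mem h, stepUp_single_mem h']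
          have := hin _ h h'
          rw [neg_add_cancel_right, e] at this
          rw [← this]
          congr 1
          · exact Subtype.ext (by simp)
          · ring
        · rw [stepDown_single_notMem h, map_zero, ← e, hout _ (Or.inr ⟨h, by simp⟩),
            zero_mul, StringSpace.single_zero]
      · rw [map_add, map_add, hv, hw, smul_add])
    (fun v => by
      induction v using StringSpace.induction with | h0 => ?_ | hs j c => ?_ | hadd v w hv hw => ?_
      · simp only [smul_zero, map_zero]
      · rw [StringSpace.smul_single, halfShift_symm_eval]
        by_cases h : (j : ℤ) + 1 ∈ S
        · have h' : ((⟨(j : ℤ) + 1, h⟩ : S) : ℤ) + (-1) ∈ S := by simp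
          rw [stepUp_single_mem h, stepDown_single_mem h']
          rw [← hin _ j.2 h]
          congr 1
          · exact Subtype.ext (by simp)
          · ring
        · rw [stepUp_single_notMem h, map_zero, hout _ (Or.inl ⟨j.2, h⟩),
            zero_mul, StringSpace.single_zero]
      · rw [map_add, map_add, hv, hw, smul_add])
  letI : Module (A t) (StringSpace S) := Module.compHom _ f
  { carrier := StringSpace S
    coeff_smul := fun r v => actionHom_coeff _ _ _ _ r v
    isWeight := StringSpace.isIntegralWeight S }

theorem stringModule_up {t : ℂ[X]} {S : Set ℤ} {a b : ℤ → ℂ}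
    (hin : ∀ j, j ∈ S → j + 1 ∈ S → a j * b (j + 1) = t.eval ((j : ℂ) + 1 / 2))
    (hout : ∀ j, (j ∈ S ∧ j + 1 ∉ S ∨ j ∉ S ∧ j + 1 ∈ S) → t.eval ((j : ℂ) + 1 / 2) = 0)
    (v : StringSpace S) :
    Xup t • (show stringModule t S a b hin hout from v) = stepUp S a v :=
  actionHom_up _ _ _ _ v

theorem stringModule_down {t : ℂ[X]} {S : Set ℤ} {a b : ℤ → ℂ}
    (hin : ∀ j, j ∈ S → j + 1 ∈ S → a j * b (j + 1) = t.eval ((j : ℂ) + 1 / 2))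
    (hout : ∀ j, (j ∈ S ∧ j + 1 ∉ S ∨ j ∉ S ∧ j + 1 ∈ S) → t.eval ((j : ℂ) + 1 / 2) = 0)
    (v : StringSpace S) :
    Xdown t • (show stringModule t S a b hin hout from v) = stepDown S b v :=
  actionHom_down _ _ _ _ v

end stringModules

section tensor

variable {t t' t'' : ℂ[X]}

/-- The action of `X⁺` on a weight module, as a `σ`-semilinear map. -/
def WMod.up (M : WMod t) : M →ₛₗ[shiftUp] M where
  toFun v := Xup t • v
  map_add' := smul_add _
  map_smul' r v := by
    rw [← M.coeff_smul, ← mul_smul, Xup_coeff, mul_smul, M.coeff_smul]; rfl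

/-- The action of `X⁻` on a weight module, as a `σ⁻¹`-semilinear map. -/
def WMod.down (M : WMod t) : M →ₛₗ[shiftDown] M where
  toFun v := Xdown t • v
  map_add' := smul_add _
  map_smul' r v := by
    rw [← M.coeff_smul, ← mul_smul, Xdown_coeff, mul_smul, M.coeff_smul]; rfl

theorem WMod.up_down (M : WMod t) (v : M) : M.up (M.down v) = halfShift t • v := by
  change Xup t • Xdown t • v = _
  rw [← mul_smul, Xup_Xdown, M.coeff_smul]

theorem WMod.down_up (M : WMod t) (v : M) : M.down (M.up v) = halfShift.symm t • v := by
  change Xdown t • Xup t • v = _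
  rw [← mul_smul, Xdown_Xup, M.coeff_smul]

theorem tmul_eq_zero_of_ne {V W : Type} [AddCommGroup V] [Module ℂ[X] V] [AddCommGroup W]
    [Module ℂ[X] W] {μ ν : ℂ} (h : μ ≠ ν) {v : V} {w : W} (hv : v ∈ weightSpace V μ)
    (hw : w ∈ weightSpace W ν) : v ⊗ₜ[ℂ[X]] w = 0 := by
  have h1 : (Polynomial.C (ν - μ) : ℂ[X]) • (v ⊗ₜ[ℂ[X]] w) = 0 := by
    have e : (Polynomial.C (ν - μ) : ℂ[X]) = (Polynomial.X - Polynomial.C μ) -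
      (Polynomial.X - Polynomial.C ν) := by rw [map_sub]; ring
    rw [e, sub_smul, TensorProduct.smul_tmul', mem_weightSpace.1 hv, TensorProduct.zero_tmul,
      ← TensorProduct.tmul_smul, mem_weightSpace.1 hw, TensorProduct.tmul_zero, sub_zero]
  have h2 := congrArg (fun x => (Polynomial.C ((ν - μ)⁻¹) : ℂ[X]) • x) h1
  simpa only [← mul_smul, ← map_mul, inv_mul_cancel₀ (sub_ne_zero.2 h.symm), map_one, one_smul,
    smul_zero] using h2

theorem IsIntegralWeight.tensor {V W : Type} [AddCommGroup V] [Module ℂ[X] V] [AddCommGroup W]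
    [Module ℂ[X] W] (hV : IsIntegralWeight V) (hW : IsIntegralWeight W) :
    IsIntegralWeight (V ⊗[ℂ[X]] W) := by
  refine IsIntegralWeight.of_le
    (fun μ => Submodule.map₂ (TensorProduct.mk ℂ[X] V W) (weightSpace V μ) (weightSpace W μ))
    (fun μ => ?_) ?_ (fun μ => (hV.fg μ).map₂ _ (hW.fg μ)) (fun μ h => hV.support μ ?_)
  · rw [Submodule.map₂_le]
    intro v hv w _
    rw [mem_weightSpace, TensorProduct.mk_apply, TensorProduct.smul_tmul', mem_weightSpace.1 hv,
      TensorProduct.zero_tmul]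
  · rw [eq_top_iff]
    rintro x -
    induction x using TensorProduct.induction_on with
    | zero => exact Submodule.zero_mem _
    | add x y hx hy => exact Submodule.add_mem _ hx hy
    | tmul v w =>
      induction v using hV.induction with
      | hadd v v' hv hv' => rw [TensorProduct.add_tmul]; exact Submodule.add_mem _ hv hv'
      | hw μ v hv =>
        induction w using hW.induction with
        | hadd w w' hw hw' => rw [TensorProduct.tmul_add]; exact Submodule.add_mem _ hw hw'
        | hw ν w hw =>
          by_cases h : μ = ν
          · subst h
            exact Submodule.mem_iSup_of_mem μ (Submodule.apply_mem_map₂ _ hv hw)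
          · rw [tmul_eq_zero_of_ne h hv hw]; exact Submodule.zero_mem _
  · intro h0
    rw [h0, Submodule.map₂_bot_left] at h
    exact h rfl

/-- The tensor product `M ⊗_R M'` of a weight module for `A(t)` and one for `A(t')`, as a module
for `A(t t')` by restriction along `X^± ↦ X^± ⊗ X^±`, `r ↦ r ⊗ 1 = 1 ⊗ r`. -/
def WMod.tensor (M : WMod t) (M' : WMod t') : WMod (t * t') :=
  letI f := actionHom (t * t') (TensorProduct.map M.up M'.up) (TensorProduct.map M.down M'.down)
    (fun x => by
      induction x using TensorProduct.induction_on with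
      | zero => simp only [map_zero, smul_zero]
      | add x y hx hy => rw [map_add, map_add, hx, hy, smul_add]
      | tmul v w =>
        rw [TensorProduct.map_tmul, TensorProduct.map_tmul, M.up_down, M'.up_down, map_mul,
          TensorProduct.smul_tmul_smul])
    (fun x => by
      induction x using TensorProduct.induction_on with
      | zero => simp only [map_zero, smul_zero]
      | add x y hx hy => rw [map_add, map_add, hx, hy, smul_add]
      | tmul v w =>
        rw [TensorProduct.map_tmul, TensorProduct.map_tmul, M.down_up, M'.down_up, map_mul,
          TensorProduct.smul_tmul_smul])
  letI : Module (A (t * t')) (M ⊗[ℂ[X]] M') := Module.compHom _ f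
  { carrier := M ⊗[ℂ[X]] M'
    coeff_smul := fun r v => actionHom_coeff _ _ _ _ r v
    isWeight := M.isWeight.tensor M'.isWeight }

/-- The pure tensor `v ⊗ w`. -/
def WMod.tmul {M : WMod t} {M' : WMod t'} (v : M) (w : M') : M.tensor M' := v ⊗ₜ[ℂ[X]] w

theorem WMod.up_tmul {M : WMod t} {M' : WMod t'} (v : M) (w : M') :
    Xup (t * t') • WMod.tmul v w = WMod.tmul (Xup t • v) (Xup t' • w) :=
  actionHom_up _ _ _ _ (v ⊗ₜ[ℂ[X]] w)

theorem WMod.down_tmul {M : WMod t} {M' : WMod t'} (v : M) (w : M') :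
    Xdown (t * t') • WMod.tmul v w = WMod.tmul (Xdown t • v) (Xdown t' • w) :=
  actionHom_down _ _ _ _ (v ⊗ₜ[ℂ[X]] w)

theorem WMod.tensor_induction {M : WMod t} {M' : WMod t'} {p : M.tensor M' → Prop}
    (h0 : p 0) (ht : ∀ v w, p (WMod.tmul v w)) (hadd : ∀ x y, p x → p y → p (x + y))
    (x : M.tensor M') : p x :=
  TensorProduct.induction_on x h0 ht hadd

theorem map_smul_of_generators {B : Type} [AddCommGroup B] [Module (A t) B] {M : WMod t}
    (f : M →+ B) (hr : ∀ (r : ℂ[X]) v, f (r • v) = coeff t r • f v)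
    (hu : ∀ v, f (Xup t • v) = Xup t • f v) (hd : ∀ v, f (Xdown t • v) = Xdown t • f v)
    (a : A t) (v : M) : f (a • v) = a • f v := by
  induction a using A_induction generalizing v with
  | hr r => rw [M.coeff_smul, hr]
  | hu => exact hu v
  | hd => exact hd v
  | hadd a b ha hb => rw [add_smul, map_add, ha, hb, add_smul]
  | hmul a b ha hb => rw [mul_smul, ha, hb, mul_smul]

/-- An `A(t)`-linear map, seen as an `R`-linear map. -/
def WMod.restrict {M N : WMod t} (f : M →ₗ[A t] N) : M →ₗ[ℂ[X]] N where
  toFun := f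
  map_add' := map_add f
  map_smul' r v := by
    rw [← M.coeff_smul, map_smul, N.coeff_smul]; rfl

/-- Functoriality of the tensor product. -/
def WMod.tensorMap {M N : WMod t} {M' N' : WMod t'} (f : M →ₗ[A t] N) (g : M' →ₗ[A t'] N') :
    M.tensor M' →ₗ[A (t * t')] N.tensor N' :=
  letI h : M.tensor M' →ₗ[ℂ[X]] N.tensor N' :=
    TensorProduct.map (WMod.restrict f) (WMod.restrict g)
  { h with
    map_smul' := map_smul_of_generators (B := N.tensor N') (h : M.tensor M' →+ N.tensor N')
      (fun r v => by rw [(N.tensor N').coeff_smul]; exact map_smul h r v)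
      (fun v => by
        induction v using WMod.tensor_induction with
        | h0 => simp only [map_zero, smul_zero]
        | hadd x y hx hy => rw [smul_add, map_add, hx, hy, map_add, smul_add]
        | ht v w =>
          rw [WMod.up_tmul]
          change WMod.tmul (f (Xup t • v)) (g (Xup t' • w)) =
            Xup (t * t') • WMod.tmul (f v) (g w)
          rw [WMod.up_tmul, map_smul, map_smul])
      (fun v => by
        induction v using WMod.tensor_induction with
        | h0 => simp only [map_zero, smul_zero]
        | hadd x y hx hy => rw [smul_add, map_add, hx, hy, map_add, smul_add]
        | ht v w =>
          rw [WMod.down_tmul]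
          change WMod.tmul (f (Xdown t • v)) (g (Xdown t' • w)) =
            Xdown (t * t') • WMod.tmul (f v) (g w)
          rw [WMod.down_tmul, map_smul, map_smul]) }

theorem WMod.tensorMap_tmul {M N : WMod t} {M' N' : WMod t'} (f : M →ₗ[A t] N)
    (g : M' →ₗ[A t'] N') (v : M) (w : M') :
    WMod.tensorMap f g (WMod.tmul v w) = WMod.tmul (f v) (g w) := rfl

theorem WMod.tmul_add {M : WMod t} {M' : WMod t'} (v : M) (w w' : M') :
    WMod.tmul v (w + w') = WMod.tmul v w + WMod.tmul v w' := TensorProduct.tmul_add _ _ _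

theorem WMod.add_tmul {M : WMod t} {M' : WMod t'} (v v' : M) (w : M') :
    WMod.tmul (v + v') w = WMod.tmul v w + WMod.tmul v' w := TensorProduct.add_tmul _ _ _

theorem WMod.tmul_zero {M : WMod t} {M' : WMod t'} (v : M) :
    WMod.tmul v (0 : M') = 0 := TensorProduct.tmul_zero _ _

theorem WMod.zero_tmul {M : WMod t} {M' : WMod t'} (w : M') :
    WMod.tmul (0 : M) w = 0 := TensorProduct.zero_tmul _ _

end tensor

section grothendieck

variable {t t' t'' : ℂ[X]}

/-- The two kinds of Grothendieck groups. -/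
inductive Kind
  | ordinary
  | split

/-- `N` is an extension of `Q` by `M`: for the ordinary Grothendieck group there is a short exact
sequence `0 → M → N → Q → 0`, for the split one `N` is isomorphic to `M ⊕ Q`. -/
def IsExt : Kind → WMod t → WMod t → WMod t → Prop
  | Kind.ordinary, M, N, Q => ∃ (f : M →ₗ[A t] N) (g : N →ₗ[A t] Q),
      Function.Injective f ∧ Function.Exact f g ∧ Function.Surjective g
  | Kind.split, M, N, Q => Nonempty (N ≃ₗ[A t] M × Q)

/-- The subgroup generated by the elements `[N] - [M] - [Q]`. -/
def relations (κ : Kind) (t : ℂ[X]) : AddSubgroup (FreeAbelianGroup (WMod t)) :=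
  AddSubgroup.closure {x | ∃ M N Q : WMod t, IsExt κ M N Q ∧
    x = FreeAbelianGroup.of N - FreeAbelianGroup.of M - FreeAbelianGroup.of Q}

/-- The Grothendieck group `K₀(A(t)-wmod_𝒪)` (for `Kind.ordinary`) and the split Grothendieck
group `K₀^split(A(t)-wmod_𝒪)` (for `Kind.split`). -/
def K0 (κ : Kind) (t : ℂ[X]) : Type 1 := FreeAbelianGroup (WMod t) ⧸ relations κ t

instance (κ : Kind) (t : ℂ[X]) : AddCommGroup (K0 κ t) :=
  inferInstanceAs (AddCommGroup (FreeAbelianGroup (WMod t) ⧸ relations κ t))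

/-- The class `[M]`. -/
def K0.mk (κ : Kind) (M : WMod t) : K0 κ t :=
  QuotientAddGroup.mk' (relations κ t) (FreeAbelianGroup.of M)

theorem K0.mk_ext {κ : Kind} {M N Q : WMod t} (h : IsExt κ M N Q) :
    K0.mk κ N = K0.mk κ M + K0.mk κ Q := by
  have : FreeAbelianGroup.of N - FreeAbelianGroup.of M - FreeAbelianGroup.of Q ∈
      relations κ t := AddSubgroup.subset_closure ⟨M, N, Q, h, rfl⟩
  have h2 := (QuotientAddGroup.eq_zero_iff _).2 this
  have h3 : K0.mk κ N - K0.mk κ M - K0.mk κ Q = 0 := h2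
  rw [sub_sub, sub_eq_zero] at h3
  exact h3

/-- Universal property of the Grothendieck groups. -/
def K0.lift (κ : Kind) {B : Type*} [AddCommGroup B] (f : WMod t → B)
    (hf : ∀ M N Q, IsExt κ M N Q → f N = f M + f Q) : K0 κ t →+ B :=
  QuotientAddGroup.lift (relations κ t) (FreeAbelianGroup.lift f) (by
    rw [relations, AddSubgroup.closure_le]
    rintro _ ⟨M, N, Q, h, rfl⟩
    simp [hf M N Q h])

theorem K0.lift_mk (κ : Kind) {B : Type*} [AddCommGroup B] (f : WMod t → B)
    (hf : ∀ M N Q, IsExt κ M N Q → f N = f M + f Q) (M : WMod t) :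
    K0.lift κ f hf (K0.mk κ M) = f M :=
  FreeAbelianGroup.lift_apply_of f M

theorem K0.induction {κ : Kind} {p : K0 κ t → Prop} (hmk : ∀ M, p (K0.mk κ M))
    (hneg : ∀ x, p x → p (-x)) (hadd : ∀ x y, p x → p y → p (x + y)) (h0 : p 0)
    (x : K0 κ t) : p x := by
  obtain ⟨y, rfl⟩ := QuotientAddGroup.mk'_surjective (relations κ t) x
  induction y using FreeAbelianGroup.induction_on with
  | zero => exact h0
  | of M => exact hmk M
  | neg M h => exact hneg _ h
  | add x y hx hy => exact hadd _ _ hx hy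

theorem K0.hom_ext {κ : Kind} {B : Type*} [AddCommGroup B] {f g : K0 κ t →+ B}
    (h : ∀ M, f (K0.mk κ M) = g (K0.mk κ M)) : f = g := by
  ext x
  induction x using K0.induction with
  | hmk M => exact h M
  | hneg x hx => rw [map_neg, map_neg, hx]
  | hadd x y hx hy => rw [map_add, map_add, hx, hy]
  | h0 => rw [map_zero, map_zero]

theorem isExt_split_iff {M N Q : WMod t} : IsExt Kind.split M N Q ↔
    ∃ (i : M →ₗ[A t] N) (p : N →ₗ[A t] M) (j : Q →ₗ[A t] N) (q : N →ₗ[A t] Q),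
      (∀ v, p (i v) = v) ∧ (∀ v, q (j v) = v) ∧ (∀ v, p (j v) = 0) ∧ (∀ v, q (i v) = 0) ∧
      ∀ v, i (p v) + j (q v) = v := by
  constructor
  · rintro ⟨e⟩
    refine ⟨e.symm.toLinearMap ∘ₗ LinearMap.inl _ _ _, LinearMap.fst _ _ _ ∘ₗ e.toLinearMap,
      e.symm.toLinearMap ∘ₗ LinearMap.inr _ _ _, LinearMap.snd _ _ _ ∘ₗ e.toLinearMap,
      ?_, ?_, ?_, ?_, ?_⟩
    · intro v; simp
    · intro v; simp
    · intro v; simp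
    · intro v; simp
    · intro v
      simp only [LinearMap.comp_apply, LinearEquiv.coe_coe, ← map_add, LinearMap.inl_apply,
        LinearMap.inr_apply, LinearMap.fst_apply, LinearMap.snd_apply, Prod.mk_add_mk, add_zero,
        zero_add]
      exact e.symm_apply_apply v
  · rintro ⟨i, p, j, q, h1, h2, h3, h4, h5⟩
    refine ⟨LinearEquiv.ofLinearMap (p.prod q) (i.coprod j) ?_ ?_⟩
    · refine LinearMap.ext fun ⟨v, w⟩ => ?_
      simp [h1, h2, h3, h4]
    · refine LinearMap.ext fun v => ?_
      simp [h5]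

theorem tensorMap_comp_apply {M N P : WMod t} {M' N' P' : WMod t'} (f : M →ₗ[A t] N)
    (g : M' →ₗ[A t'] N') (f' : N →ₗ[A t] P) (g' : N' →ₗ[A t'] P') (x : M.tensor M') :
    WMod.tensorMap f' g' (WMod.tensorMap f g x) = WMod.tensorMap (f' ∘ₗ f) (g' ∘ₗ g) x := by
  induction x using WMod.tensor_induction with
  | h0 => simp only [map_zero]
  | hadd x y hx hy => simp only [map_add, hx, hy]
  | ht v w => rfl

theorem IsExt.tensor_right {κ : Kind} {M N Q : WMod t} (h : IsExt κ M N Q) (P : WMod t') :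
    IsExt κ (M.tensor P) (N.tensor P) (Q.tensor P) := by
  cases κ with
  | split =>
    rw [isExt_split_iff] at h ⊢
    obtain ⟨i, p, j, q, h1, h2, h3, h4, h5⟩ := h
    refine ⟨WMod.tensorMap i LinearMap.id, WMod.tensorMap p LinearMap.id,
      WMod.tensorMap j LinearMap.id, WMod.tensorMap q LinearMap.id, ?_, ?_, ?_, ?_, ?_⟩ <;> intro x
    all_goals
      induction x using WMod.tensor_induction with
      | h0 => simp only [map_zero, add_zero]
      | hadd x y hx hy =>
        first
        | rw [map_add, map_add, hx, hy, add_zero]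
        | rw [map_add, map_add, hx, hy]
        | (conv_rhs => rw [← hx, ← hy]
           simp only [map_add]
           abel)
      | ht v w => simp only [WMod.tensorMap_tmul, LinearMap.id_apply, h1, h2, h3, h4,
          WMod.zero_tmul, ← WMod.add_tmul, h5]
  | ordinary =>
    obtain ⟨f, g, hf, hfg, hg⟩ := h
    refine ⟨WMod.tensorMap f LinearMap.id, WMod.tensorMap g LinearMap.id, ?_, ?_, ?_⟩
    · have := N.isWeight.isSemisimple
      obtain ⟨s, hs⟩ := IsSemisimpleModule.extension_property (WMod.restrict f) hf
        (LinearMap.id (R := ℂ[X]) (M := M))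
      refine Function.LeftInverse.injective (g := TensorProduct.map s LinearMap.id) (fun x => ?_)
      induction x using WMod.tensor_induction with
      | h0 => exact (congrArg _ (map_zero _)).trans (map_zero _)
      | hadd x y hx hy => rw [map_add]; exact (map_add _ _ _).trans (congrArg₂ _ hx hy)
      | ht v w =>
        rw [WMod.tensorMap_tmul]
        exact congrArg (fun u => u ⊗ₜ[ℂ[X]] w) (LinearMap.congr_fun hs v)
    · exact rTensor_exact P (f := WMod.restrict f) (g := WMod.restrict g) hfg hg
    · exact LinearMap.rTensor_surjective P (g := WMod.restrict g) hg

theorem IsExt.tensor_left {κ : Kind} {M N Q : WMod t'} (P : WMod t) (h : IsExt κ M N Q) :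
    IsExt κ (P.tensor M) (P.tensor N) (P.tensor Q) := by
  cases κ with
  | split =>
    rw [isExt_split_iff] at h ⊢
    obtain ⟨i, p, j, q, h1, h2, h3, h4, h5⟩ := h
    refine ⟨WMod.tensorMap LinearMap.id i, WMod.tensorMap LinearMap.id p,
      WMod.tensorMap LinearMap.id j, WMod.tensorMap LinearMap.id q, ?_, ?_, ?_, ?_, ?_⟩ <;> intro x
    all_goals
      induction x using WMod.tensor_induction with
      | h0 => simp only [map_zero, add_zero]
      | hadd x y hx hy =>
        first
        | rw [map_add, map_add, hx, hy, add_zero]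
        | rw [map_add, map_add, hx, hy]
        | (conv_rhs => rw [← hx, ← hy]
           simp only [map_add]
           abel)
      | ht v w => simp only [WMod.tensorMap_tmul, LinearMap.id_apply, h1, h2, h3, h4,
          WMod.tmul_zero, ← WMod.tmul_add, h5]
  | ordinary =>
    obtain ⟨f, g, hf, hfg, hg⟩ := h
    refine ⟨WMod.tensorMap LinearMap.id f, WMod.tensorMap LinearMap.id g, ?_, ?_, ?_⟩
    · have := N.isWeight.isSemisimple
      obtain ⟨s, hs⟩ := IsSemisimpleModule.extension_property (WMod.restrict f) hf
        (LinearMap.id (R := ℂ[X]) (M := M))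
      refine Function.LeftInverse.injective (g := TensorProduct.map LinearMap.id s) (fun x => ?_)
      induction x using WMod.tensor_induction with
      | h0 => exact (congrArg _ (map_zero _)).trans (map_zero _)
      | hadd x y hx hy => rw [map_add]; exact (map_add _ _ _).trans (congrArg₂ _ hx hy)
      | ht v w =>
        rw [WMod.tensorMap_tmul]
        exact congrArg (fun u => v ⊗ₜ[ℂ[X]] u) (LinearMap.congr_fun hs w)
    · exact lTensor_exact P (f := WMod.restrict f) (g := WMod.restrict g) hfg hg
    · exact LinearMap.lTensor_surjective P (g := WMod.restrict g) hg

/-- The product `K₀(A(t)) × K₀(A(t')) → K₀(A(t t'))`, `[M] [M'] = [M ⊗_R M']`. -/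
def K0.mul (κ : Kind) (t t' : ℂ[X]) : K0 κ t →+ K0 κ t' →+ K0 κ (t * t') :=
  K0.lift κ (fun M => K0.lift κ (fun M' => K0.mk κ (M.tensor M'))
      (fun _ _ _ h => K0.mk_ext (h.tensor_left M)))
    (fun M N Q h => K0.hom_ext fun P => by
      rw [AddMonoidHom.add_apply, K0.lift_mk, K0.lift_mk, K0.lift_mk]
      exact K0.mk_ext (h.tensor_right P))

theorem K0.mul_mk (κ : Kind) (M : WMod t) (M' : WMod t') :
    K0.mul κ t t' (K0.mk κ M) (K0.mk κ M') = K0.mk κ (M.tensor M') := by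
  unfold K0.mul
  rw [K0.lift_mk, K0.lift_mk]

/-- The canonical map `K₀^split(A(t)-wmod_𝒪) → K₀(A(t)-wmod_𝒪)`, `[M] ↦ [M]`. -/
def K0.canonical (t : ℂ[X]) : K0 Kind.split t →+ K0 Kind.ordinary t :=
  K0.lift Kind.split (K0.mk Kind.ordinary) (fun M N Q h => by
    obtain ⟨i, p, j, q, h1, h2, h3, h4, h5⟩ := isExt_split_iff.1 h
    refine K0.mk_ext ⟨i, q, Function.LeftInverse.injective h1, fun v => ⟨fun hv => ?_, ?_⟩,
      Function.RightInverse.surjective h2⟩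
    · refine ⟨p v, ?_⟩
      have := h5 v
      rwa [hv, map_zero, add_zero] at this
    · rintro ⟨w, rfl⟩
      exact h4 w)

end grothendieck

section algebra

variable {t t' t'' : ℂ[X]}

/-- Isomorphism of weight modules over algebras `A(t)`, `A(t')` with possibly different names
`t`, `t'` of the parameter. -/
def WMod.Iso (M : WMod t) (M' : WMod t') : Prop :=
  ∃ e : M ≃ₗ[ℂ[X]] M', (∀ v, e (Xup t • v) = Xup t' • e v) ∧
    ∀ v, e (Xdown t • v) = Xdown t' • e v

/-- The zero module. -/
def WMod.zero (t : ℂ[X]) : WMod t :=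
  stringModule t ∅ 0 0 (fun _ h => h.elim) (fun _ h => (h.elim (fun h => h.1) (fun h => h.2)).elim)

theorem WMod.subsingleton_zero (t : ℂ[X]) : Subsingleton (WMod.zero t) :=
  inferInstanceAs (Subsingleton ((∅ : Set ℤ) →₀ ℂ))

theorem IsExt.zero_right {κ : Kind} {M N : WMod t} (e : N ≃ₗ[A t] M) :
    IsExt κ M N (WMod.zero t) := by
  have := WMod.subsingleton_zero t
  cases κ with
  | split =>
    exact isExt_split_iff.2 ⟨e.symm.toLinearMap, e.toLinearMap, 0, 0, fun v => e.apply_symm_apply v,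
      fun v => Subsingleton.elim _ _, fun v => by simp, fun v => rfl, fun v => by simp⟩
  | ordinary =>
    exact ⟨e.symm.toLinearMap, 0, e.symm.injective,
      fun v => ⟨fun _ => ⟨e v, e.symm_apply_apply v⟩, fun _ => rfl⟩, fun v =>
        ⟨0, Subsingleton.elim _ _⟩⟩

theorem K0.mk_eq {κ : Kind} {M N : WMod t} (e : N ≃ₗ[A t] M) : K0.mk κ N = K0.mk κ M := by
  have h0 : K0.mk κ (WMod.zero t) = 0 := by
    have := K0.mk_ext (IsExt.zero_right (κ := κ) (LinearEquiv.refl (A t) (WMod.zero t)))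
    rwa [left_eq_add] at this
  rw [K0.mk_ext (IsExt.zero_right e), h0, add_zero]

theorem WMod.Iso.mk_eq {κ : Kind} {M N : WMod t} (h : N.Iso M) : K0.mk κ N = K0.mk κ M := by
  obtain ⟨e, hu, hd⟩ := h
  exact K0.mk_eq { e with
    map_smul' := map_smul_of_generators (B := M) (e : N →+ M)
      (fun r v => by rw [M.coeff_smul]; exact map_smul e r v) hu hd }

theorem WMod.Iso.assoc (M : WMod t) (M' : WMod t') (M'' : WMod t'') :
    ((M.tensor M').tensor M'').Iso (M.tensor (M'.tensor M'')) := by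
  obtain ⟨e, he⟩ : ∃ e : (M.tensor M').tensor M'' ≃ₗ[ℂ[X]] M.tensor (M'.tensor M''),
      ∀ v w u, e (WMod.tmul (WMod.tmul v w) u) = WMod.tmul v (WMod.tmul w u) :=
    ⟨TensorProduct.assoc ℂ[X] M M' M'', fun _ _ _ => rfl⟩
  refine ⟨e, fun x => ?_, fun x => ?_⟩
  · induction x using WMod.tensor_induction with
    | h0 => rw [smul_zero, map_zero, smul_zero]
    | hadd x y hx hy => rw [smul_add, map_add, map_add, hx, hy, smul_add]
    | ht x u =>
      induction x using WMod.tensor_induction with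
      | h0 => rw [WMod.zero_tmul, smul_zero, map_zero, smul_zero]
      | hadd x y hx hy => rw [WMod.add_tmul, smul_add, map_add, map_add, hx, hy, smul_add]
      | ht v w =>
        rw [WMod.up_tmul, WMod.up_tmul, he, he, WMod.up_tmul, WMod.up_tmul]
  · induction x using WMod.tensor_induction with
    | h0 => rw [smul_zero, map_zero, smul_zero]
    | hadd x y hx hy => rw [smul_add, map_add, map_add, hx, hy, smul_add]
    | ht x u =>
      induction x using WMod.tensor_induction with
      | h0 => rw [WMod.zero_tmul, smul_zero, map_zero, smul_zero]
      | hadd x y hx hy => rw [WMod.add_tmul, smul_add, map_add, map_add, hx, hy, smul_add]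
      | ht v w =>
        rw [WMod.down_tmul, WMod.down_tmul, he, he, WMod.down_tmul, WMod.down_tmul]

theorem WMod.Iso.comm (M : WMod t) (M' : WMod t') : (M.tensor M').Iso (M'.tensor M) := by
  obtain ⟨e, he⟩ : ∃ e : M.tensor M' ≃ₗ[ℂ[X]] M'.tensor M,
      ∀ v w, e (WMod.tmul v w) = WMod.tmul w v :=
    ⟨TensorProduct.comm ℂ[X] M M', fun _ _ => rfl⟩
  refine ⟨e, fun x => ?_, fun x => ?_⟩
  · induction x using WMod.tensor_induction with
    | h0 => rw [smul_zero, map_zero, smul_zero]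
    | hadd x y hx hy => rw [smul_add, map_add, map_add, hx, hy, smul_add]
    | ht v w =>
      rw [WMod.up_tmul, he, he, WMod.up_tmul]
  · induction x using WMod.tensor_induction with
    | h0 => rw [smul_zero, map_zero, smul_zero]
    | hadd x y hx hy => rw [smul_add, map_add, map_add, hx, hy, smul_add]
    | ht v w =>
      rw [WMod.down_tmul, he, he, WMod.down_tmul]

/-- The simple module `M^1` over `A(1)`: basis `v_j`, `j ∈ ℤ`, and `X^± v_j = v_{j±1}`. -/
def unitModule : WMod 1 :=
  stringModule 1 Set.univ 1 1 (fun _ _ _ => by simp) (fun _ h => by simp at h)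

/-- The basis vector `v_j` of `M^1`. -/
def unitVec (j : ℤ) : unitModule := StringSpace.single (⟨j, trivial⟩ : (Set.univ : Set ℤ)) 1

theorem up_unitVec (j : ℤ) : Xup 1 • unitVec j = unitVec (j + 1) := by
  have h : Xup 1 • unitVec j = stepUp Set.univ 1 (StringSpace.single ⟨j, trivial⟩ 1) :=
    stringModule_up _ _ _
  rw [h]
  refine (stepUp_single_mem (S := Set.univ) trivial _).trans ?_
  rw [Pi.one_apply, one_mul]; rfl

theorem down_unitVec (j : ℤ) : Xdown 1 • unitVec j = unitVec (j - 1) := by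
  have h : Xdown 1 • unitVec j = stepDown Set.univ 1 (StringSpace.single ⟨j, trivial⟩ 1) :=
    stringModule_down _ _ _
  rw [h]
  refine (stepDown_single_mem (S := Set.univ) trivial _).trans ?_
  rw [Pi.one_apply, one_mul]; rfl

theorem smul_unitVec (r : ℂ[X]) (j : ℤ) :
    r • unitVec j = StringSpace.single (⟨j, trivial⟩ : (Set.univ : Set ℤ)) (r.eval (j : ℂ)) := by
  have h := StringSpace.smul_single r (⟨j, trivial⟩ : (Set.univ : Set ℤ)) 1
  rw [mul_one] at h
  exact h

theorem unitVec_mem (j : ℤ) : unitVec j ∈ weightSpace unitModule (j : ℂ) := by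
  rw [mem_weightSpace, smul_unitVec]
  simp [StringSpace.single_zero]
  rfl

theorem unitVec_induction {p : unitModule → Prop} (h0 : p 0)
    (hs : ∀ j c, p ((Polynomial.C c : ℂ[X]) • unitVec j)) (hadd : ∀ v w, p v → p w → p (v + w))
    (v : unitModule) : p v := by
  refine StringSpace.induction (p := p) h0 (fun j c => ?_) hadd v
  have := hs j c
  rw [smul_unitVec, Polynomial.eval_C] at this
  exact this

theorem exists_of_weights (M : WMod t) {B : Type*} [AddCommGroup B] [Module ℂ[X] B]
    (g : ∀ μ, weightSpace M μ →ₗ[ℂ[X]] B) :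
    ∃ f : M →ₗ[ℂ[X]] B, ∀ μ (v : weightSpace M μ), f v = g μ v := by
  classical
  let e : (⨁ μ, weightSpace M μ) ≃ₗ[ℂ[X]] M :=
    LinearEquiv.ofBijective (DirectSum.coeLinearMap (weightSpace M)) M.isWeight.isInternal
  refine ⟨DirectSum.toModule ℂ[X] ℂ B g ∘ₗ e.symm.toLinearMap, fun μ v => ?_⟩
  have h : e.symm (v : M) = DirectSum.lof ℂ[X] ℂ (fun μ => weightSpace M μ) μ v := by
    rw [LinearEquiv.symm_apply_eq]
    exact Eq.symm (DirectSum.coeLinearMap_lof (weightSpace M) μ v)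
  rw [LinearMap.comp_apply, LinearEquiv.coe_coe, h, DirectSum.toModule_lof]

theorem exists_unitors (M : WMod t) :
    ∃ (ρ : M →ₗ[ℂ[X]] M.tensor unitModule) (ψ : M.tensor unitModule →ₗ[ℂ[X]] M),
      (∀ (j : ℤ), ∀ v ∈ weightSpace M (j : ℂ), ρ v = WMod.tmul v (unitVec j)) ∧
      (∀ (j : ℤ), ∀ v ∈ weightSpace M (j : ℂ), ψ (WMod.tmul v (unitVec j)) = v) := by
  have h1 : ∀ μ : ℂ, ∃ g : weightSpace M μ →ₗ[ℂ[X]] M.tensor unitModule,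
      ∀ n : ℤ, μ = n → ∀ v, g v = WMod.tmul (v : M) (unitVec n) := by
    intro μ
    by_cases h : ∃ n : ℤ, μ = n
    · obtain ⟨n, rfl⟩ := h
      refine ⟨(TensorProduct.mk ℂ[X] M unitModule).flip (unitVec n) ∘ₗ
        (weightSpace M (n : ℂ)).subtype, fun m hm v => ?_⟩
      obtain rfl : n = m := Int.cast_injective hm
      rfl
    · exact ⟨0, fun n hn => (h ⟨n, hn⟩).elim⟩
  have h2 : ∀ μ : ℂ, ∃ g : weightSpace M μ →ₗ[ℂ[X]] (unitModule →ₗ[ℂ[X]] M),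
      ∀ n : ℤ, μ = n → ∀ v, g v (unitVec n) = v := by
    intro μ
    by_cases h : ∃ n : ℤ, μ = n
    · obtain ⟨n, rfl⟩ := h
      let c : unitModule → ℂ := fun f => (show (Set.univ : Set ℤ) →₀ ℂ from f) ⟨n, trivial⟩
      refine ⟨LinearMap.mk₂ ℂ[X] (fun v f => (Polynomial.C (c f) : ℂ[X]) • (v : M))
        (fun v w f => smul_add _ _ _) (fun r v f => smul_comm _ _ _) (fun v f f' => ?_)
        (fun r v f => ?_), fun m hm v => ?_⟩
      · rw [show c (f + f') = c f + c f' from rfl, map_add, add_smul]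
      · rw [show c (r • f) = r.eval (n : ℂ) * c f from rfl, map_mul, mul_comm, mul_smul,
          ← smul_of_mem_weightSpace v.2, smul_comm]
      · obtain rfl : n = m := Int.cast_injective hm
        rw [LinearMap.mk₂_apply, show c (unitVec n) = 1 from
          Finsupp.single_eq_same, map_one, one_smul]
    · exact ⟨0, fun n hn => (h ⟨n, hn⟩).elim⟩
  choose g hg using h1
  choose g' hg' using h2
  obtain ⟨ρ, hρ⟩ := exists_of_weights M g
  obtain ⟨ψ, hψ⟩ := exists_of_weights M g'
  refine ⟨ρ, TensorProduct.lift ψ, fun j v hv => ?_, fun j v hv => ?_⟩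
  · exact (hρ j ⟨v, hv⟩).trans (hg _ j rfl _)
  · exact (LinearMap.congr_fun (hψ j ⟨v, hv⟩) (unitVec j)).trans (hg' _ j rfl ⟨v, hv⟩)

theorem WMod.induction_int {M : WMod t} {p : M → Prop}
    (hw : ∀ j : ℤ, ∀ v ∈ weightSpace M (j : ℂ), p v)
    (hadd : ∀ v w, p v → p w → p (v + w)) (v : M) : p v := by
  refine M.isWeight.induction (fun μ v hv => ?_) hadd v
  by_cases h : weightSpace M μ = ⊥
  · rw [h, Submodule.mem_bot] at hv
    rw [hv]
    exact hw 0 0 (Submodule.zero_mem _)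
  · obtain ⟨n, rfl⟩ := M.isWeight.support μ h
    exact hw n v hv

theorem WMod.up_mem {M : WMod t} {j : ℤ} {v : M} (hv : v ∈ weightSpace M (j : ℂ)) :
    Xup t • v ∈ weightSpace M ((j + 1 : ℤ) : ℂ) := by
  rw [mem_weightSpace] at hv ⊢
  have e : Polynomial.X - Polynomial.C (((j + 1 : ℤ) : ℂ)) =
      shiftUp (Polynomial.X - Polynomial.C (j : ℂ)) := by
    refine Polynomial.funext fun x => ?_
    change _ = Polynomial.eval x (shift _)
    rw [shift_eval]
    simp only [Polynomial.eval_sub, Polynomial.eval_X, Polynomial.eval_C]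
    push_cast
    ring
  rw [e]
  have := map_smulₛₗ M.up (Polynomial.X - Polynomial.C (j : ℂ)) v
  rw [hv, map_zero] at this
  exact this.symm

theorem WMod.down_mem {M : WMod t} {j : ℤ} {v : M} (hv : v ∈ weightSpace M (j : ℂ)) :
    Xdown t • v ∈ weightSpace M ((j - 1 : ℤ) : ℂ) := by
  rw [mem_weightSpace] at hv ⊢
  have e : Polynomial.X - Polynomial.C (((j - 1 : ℤ) : ℂ)) =
      shiftDown (Polynomial.X - Polynomial.C (j : ℂ)) := by
    refine Polynomial.funext fun x => ?_
    change _ = Polynomial.eval x (shift.symm _)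
    rw [shift_symm_eval]
    simp only [Polynomial.eval_sub, Polynomial.eval_X, Polynomial.eval_C]
    push_cast
    ring
  rw [e]
  have := map_smulₛₗ M.down (Polynomial.X - Polynomial.C (j : ℂ)) v
  rw [hv, map_zero] at this
  exact this.symm

theorem WMod.Iso.unit (M : WMod t) : M.Iso (M.tensor unitModule) := by
  obtain ⟨ρ, ψ, hρ, hψ⟩ := exists_unitors M
  have h1 : ∀ v, ψ (ρ v) = v := by
    intro v
    induction v using WMod.induction_int with
    | hw j v hv => rw [hρ j v hv, hψ j v hv]
    | hadd v w hv hw => rw [map_add, map_add, hv, hw]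
  have h2 : ∀ x, ρ (ψ x) = x := by
    intro x
    induction x using WMod.tensor_induction with
    | h0 => rw [map_zero, map_zero]
    | hadd x y hx hy => rw [map_add, map_add, hx, hy]
    | ht v w =>
      induction v using WMod.induction_int with
      | hadd v v' hv hv' => rw [WMod.add_tmul, map_add, map_add, hv, hv']
      | hw j v hv =>
        induction w using unitVec_induction with
        | h0 => rw [WMod.tmul_zero, map_zero, map_zero]
        | hadd w w' hw hw' => rw [WMod.tmul_add, map_add, map_add, hw, hw']
        | hs i c =>
          have hc : WMod.tmul v ((Polynomial.C c : ℂ[X]) • unitVec i) =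
              (Polynomial.C c : ℂ[X]) • WMod.tmul v (unitVec i) :=
            TensorProduct.tmul_smul _ _ _
          rw [hc, map_smul, map_smul]
          by_cases h : j = i
          · subst h
            rw [hψ j v hv, hρ j v hv]
          · have : WMod.tmul v (unitVec i) = 0 :=
              tmul_eq_zero_of_ne (fun h' => h (Int.cast_injective h')) hv (unitVec_mem i)
            rw [this, map_zero, map_zero]
  refine ⟨LinearEquiv.ofLinearMap ρ ψ (LinearMap.ext h2) (LinearMap.ext h1), fun v => ?_,
    fun v => ?_⟩
  · change ρ _ = _ • ρ _
    induction v using WMod.induction_int with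
    | hw j v hv => rw [hρ _ _ (WMod.up_mem hv), hρ j v hv, WMod.up_tmul, up_unitVec]
    | hadd v w hv hw => rw [smul_add, map_add, map_add, hv, hw, smul_add]
  · change ρ _ = _ • ρ _
    induction v using WMod.induction_int with
    | hw j v hv => rw [hρ _ _ (WMod.down_mem hv), hρ j v hv, WMod.down_tmul, down_unitVec]
    | hadd v w hv hw => rw [smul_add, map_add, map_add, hv, hw, smul_add]

/-- The underlying graded vector space `⨁_{t ∈ Γ} ℂ ⊗_ℤ K₀(A(t)-wmod_𝒪)` (respectively with
`K₀^split`) of the algebras `𝒜(Γ,𝒪)` and `𝒜^split(Γ,𝒪)`. -/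
def GrothendieckAlgebra (κ : Kind) (Γ : Submonoid ℂ[X]) : Type 1 :=
  ⨁ t : Γ, ℂ ⊗[ℤ] K0 κ (t : ℂ[X])

namespace GrothendieckAlgebra

variable {κ : Kind} {Γ : Submonoid ℂ[X]}

instance : AddCommGroup (GrothendieckAlgebra κ Γ) :=
  inferInstanceAs (AddCommGroup (⨁ t : Γ, ℂ ⊗[ℤ] K0 κ (t : ℂ[X])))

instance : Module ℂ (GrothendieckAlgebra κ Γ) :=
  inferInstanceAs (Module ℂ (⨁ t : Γ, ℂ ⊗[ℤ] K0 κ (t : ℂ[X])))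

open Classical in
/-- The inclusion of the summand of degree `t`. -/
def incl (κ : Kind) (t : Γ) : ℂ ⊗[ℤ] K0 κ (t : ℂ[X]) →ₗ[ℂ] GrothendieckAlgebra κ Γ :=
  DirectSum.lof ℂ Γ (fun t : Γ => ℂ ⊗[ℤ] K0 κ (t : ℂ[X])) t

open Classical in
/-- The linear map with given restrictions to the summands. -/
def lift {B : Type*} [AddCommGroup B] [Module ℂ B]
    (f : ∀ t : Γ, ℂ ⊗[ℤ] K0 κ (t : ℂ[X]) →ₗ[ℂ] B) : GrothendieckAlgebra κ Γ →ₗ[ℂ] B :=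
  DirectSum.toModule ℂ Γ B f

theorem lift_incl {B : Type*} [AddCommGroup B] [Module ℂ B]
    (f : ∀ t : Γ, ℂ ⊗[ℤ] K0 κ (t : ℂ[X]) →ₗ[ℂ] B) (t : Γ) (x : ℂ ⊗[ℤ] K0 κ (t : ℂ[X])) :
    lift f (incl κ t x) = f t x := by
  classical
  exact DirectSum.toModule_lof (M := fun t : Γ => ℂ ⊗[ℤ] K0 κ (t : ℂ[X])) ℂ t x

/-- The class `[M]`, in degree `t`, of a weight module `M` over `A(t)`. -/
def cls (κ : Kind) (t : Γ) (M : WMod (t : ℂ[X])) : GrothendieckAlgebra κ Γ :=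
  incl κ t (1 ⊗ₜ K0.mk κ M)

theorem cls_congr {s t : Γ} (h : s = t) {M : WMod (s : ℂ[X])} {N : WMod (t : ℂ[X])}
    (e : M.Iso N) : cls κ s M = cls κ t N := by
  subst h
  rw [cls, cls, e.mk_eq]

theorem induction {p : GrothendieckAlgebra κ Γ → Prop} (hcls : ∀ t M, p (cls κ t M))
    (hsmul : ∀ (c : ℂ) x, p x → p (c • x)) (hadd : ∀ x y, p x → p y → p (x + y))
    (x : GrothendieckAlgebra κ Γ) : p x := by
  classical
  have h0 : p 0 := by
    have := hsmul 0 _ (hcls 1 unitModule)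
    rwa [zero_smul] at this
  refine DirectSum.induction_on (motive := p) x h0 (fun t y => ?_) hadd
  change p (incl κ t y)
  induction y using TensorProduct.induction_on with
  | zero => rw [map_zero]; exact h0
  | add x y hx hy => rw [map_add]; exact hadd _ _ hx hy
  | tmul c y =>
    have e : c ⊗ₜ[ℤ] y = c • ((1 : ℂ) ⊗ₜ[ℤ] y) := by
      rw [TensorProduct.smul_tmul', smul_eq_mul, mul_one]
    rw [e, map_smul]
    apply hsmul
    clear e
    induction y using K0.induction with
    | hmk M => exact hcls t M
    | h0 => rw [TensorProduct.tmul_zero, map_zero]; exact h0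
    | hneg y hy =>
      rw [TensorProduct.tmul_neg, map_neg, ← neg_one_smul ℂ]; exact hsmul _ _ hy
    | hadd x y hx hy => rw [TensorProduct.tmul_add, map_add]; exact hadd _ _ hx hy

/-- The product `(c ⊗ x, d ⊗ y) ↦ cd ⊗ xy` of homogeneous elements. -/
def gradedMul (κ : Kind) (s t : ℂ[X]) :
    ℂ ⊗[ℤ] K0 κ s →ₗ[ℂ] ℂ ⊗[ℤ] K0 κ t →ₗ[ℂ] ℂ ⊗[ℤ] K0 κ (s * t) :=
  TensorProduct.AlgebraTensorModule.lift
    { toFun := fun c =>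
        { toFun := fun x => c • (K0.mul κ s t x).toIntLinearMap.baseChange ℂ
          map_add' := fun x y => by
            ext; simp [TensorProduct.tmul_add]
          map_smul' := fun n x => by
            ext y
            simp [smul_comm c n] }
      map_add' := fun c d => by ext; simp [add_smul]
      map_smul' := fun c d => by ext; simp [mul_smul] }

theorem gradedMul_tmul (s t : ℂ[X]) (c d : ℂ) (x : K0 κ s) (y : K0 κ t) :
    gradedMul κ s t (c ⊗ₜ x) (d ⊗ₜ y) = (c * d) ⊗ₜ K0.mul κ s t x y := by
  simp [gradedMul, TensorProduct.smul_tmul']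

/-- The inclusion of the summand of degree `s t`. -/
def inclMul (κ : Kind) (s t : Γ) :
    ℂ ⊗[ℤ] K0 κ ((s : ℂ[X]) * (t : ℂ[X])) →ₗ[ℂ] GrothendieckAlgebra κ Γ :=
  incl κ (s * t)

/-- Multiplication of homogeneous elements of degrees `s` and `t`. -/
def homMul (κ : Kind) (s t : Γ) : ℂ ⊗[ℤ] K0 κ (s : ℂ[X]) →ₗ[ℂ] ℂ ⊗[ℤ] K0 κ (t : ℂ[X]) →ₗ[ℂ]
    GrothendieckAlgebra κ Γ :=
  (gradedMul κ (s : ℂ[X]) (t : ℂ[X])).compr₂ (inclMul κ s t)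

/-- The multiplication as a bilinear map. -/
def mulMap (κ : Kind) (Γ : Submonoid ℂ[X]) :
    GrothendieckAlgebra κ Γ →ₗ[ℂ] GrothendieckAlgebra κ Γ →ₗ[ℂ] GrothendieckAlgebra κ Γ :=
  lift fun s => (lift fun t => (homMul κ s t).flip).flip

theorem mulMap_cls (s t : Γ) (M : WMod (s : ℂ[X])) (N : WMod (t : ℂ[X])) :
    mulMap κ Γ (cls κ s M) (cls κ t N) = cls κ (s * t) (M.tensor N) := by
  unfold mulMap
  rw [cls, cls, lift_incl, LinearMap.flip_apply, lift_incl, LinearMap.flip_apply, homMul,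
    LinearMap.compr₂_apply, gradedMul_tmul, one_mul, K0.mul_mk]
  rfl

theorem mulMap_comm (x y : GrothendieckAlgebra κ Γ) : mulMap κ Γ x y = mulMap κ Γ y x := by
  induction x using induction with
  | hsmul c x hx => rw [map_smul, map_smul, LinearMap.smul_apply, hx]
  | hadd x x' hx hx' => rw [map_add, map_add, LinearMap.add_apply, hx, hx']
  | hcls s M =>
    induction y using induction with
    | hsmul c x hx => rw [map_smul, map_smul, LinearMap.smul_apply, hx]
    | hadd x x' hx hx' => rw [map_add, map_add, LinearMap.add_apply, hx, hx']
    | hcls t N =>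
      rw [mulMap_cls, mulMap_cls]
      exact cls_congr (mul_comm s t) (WMod.Iso.comm M N)

theorem mulMap_assoc (x y z : GrothendieckAlgebra κ Γ) :
    mulMap κ Γ (mulMap κ Γ x y) z = mulMap κ Γ x (mulMap κ Γ y z) := by
  induction x using induction with
  | hsmul c x hx => simp only [map_smul, LinearMap.smul_apply, hx]
  | hadd x x' hx hx' => simp only [map_add, LinearMap.add_apply, hx, hx']
  | hcls s M =>
    induction y using induction with
    | hsmul c x hx => simp only [map_smul, LinearMap.smul_apply, hx]
    | hadd x x' hx hx' => simp only [map_add, LinearMap.add_apply, hx, hx']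
    | hcls t N =>
      induction z using induction with
      | hsmul c x hx => simp only [map_smul, hx]
      | hadd x x' hx hx' => simp only [map_add, hx, hx']
      | hcls u P =>
        simp only [mulMap_cls]
        exact cls_congr (mul_assoc s t u) (WMod.Iso.assoc M N P)

theorem mulMap_one (x : GrothendieckAlgebra κ Γ) :
    mulMap κ Γ x (cls κ 1 unitModule) = x := by
  induction x using induction with
  | hsmul c x hx => rw [map_smul, LinearMap.smul_apply, hx]
  | hadd x x' hx hx' => rw [map_add, LinearMap.add_apply, hx, hx']
  | hcls s M =>
    rw [mulMap_cls]
    exact (cls_congr (mul_one s).symm (WMod.Iso.unit M)).symm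

/-- `𝒜(Γ,𝒪)` and `𝒜^split(Γ,𝒪)` are commutative rings with `[M] [N] = [M ⊗_R N]` and
`1 = [M^1]`. -/
instance : CommRing (GrothendieckAlgebra κ Γ) :=
  { (inferInstance : AddCommGroup (GrothendieckAlgebra κ Γ)) with
    mul := fun x y => mulMap κ Γ x y
    one := cls κ 1 unitModule
    left_distrib := fun x y z => map_add (mulMap κ Γ x) y z
    right_distrib := fun x y z => LinearMap.map_add₂ (mulMap κ Γ) x y z
    zero_mul := fun x => LinearMap.map_zero₂ (mulMap κ Γ) x
    mul_zero := fun x => map_zero (mulMap κ Γ x)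
    mul_assoc := mulMap_assoc
    mul_comm := mulMap_comm
    mul_one := mulMap_one
    one_mul := fun x => (mulMap_comm _ _).trans (mulMap_one x) }

instance : Algebra ℂ (GrothendieckAlgebra κ Γ) :=
  Algebra.ofModule (fun c x y => LinearMap.map_smul₂ (mulMap κ Γ) c x y)
    (fun c x y => map_smul (mulMap κ Γ x) c y)

theorem cls_mul_cls (s t : Γ) (M : WMod (s : ℂ[X])) (N : WMod (t : ℂ[X])) :
    cls κ s M * cls κ t N = cls κ (s * t) (M.tensor N) := mulMap_cls s t M N

theorem one_eq : (1 : GrothendieckAlgebra κ Γ) = cls κ 1 unitModule := rfl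

/-- The canonical `ℂ`-linear map `𝒜^split(Γ,𝒪) → 𝒜(Γ,𝒪)`: the direct sum over `t ∈ Γ` of the
complexifications of the canonical maps `K₀^split → K₀`, `[M] ↦ [M]`. -/
def canonicalMap (Γ : Submonoid ℂ[X]) :
    GrothendieckAlgebra Kind.split Γ →ₗ[ℂ] GrothendieckAlgebra Kind.ordinary Γ :=
  DirectSum.lmap fun t : Γ => (K0.canonical (t : ℂ[X])).toIntLinearMap.baseChange ℂ

end GrothendieckAlgebra

end algebra

section generators

/-- The set `ℤ + 1/2` of half-integers. -/
def halfIntegers : Set ℝ := {k | ∃ m : ℤ, k = m + 1 / 2}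

/-- The polynomial `z - k`. -/
def linearPoly (k : halfIntegers) : ℂ[X] := Polynomial.X - Polynomial.C ((k : ℝ) : ℂ)

theorem linearPoly_eval (k : halfIntegers) (x : ℂ) : (linearPoly k).eval x = x - (k : ℝ) := by
  simp [linearPoly]

theorem linearPoly_eval_eq_zero {k : halfIntegers} {j : ℤ} (h1 : (j : ℝ) ≤ k)
    (h2 : (k : ℝ) ≤ (j + 1 : ℤ)) : (linearPoly k).eval ((j : ℂ) + 1 / 2) = 0 := by
  obtain ⟨k, m, rfl⟩ := k
  push_cast at h1 h2
  have h3 : (j : ℝ) < ((m + 1 : ℤ) : ℝ) := by push_cast; linarith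
  have h4 : (m : ℝ) < ((j + 1 : ℤ) : ℝ) := by push_cast; linarith
  rw [Int.cast_lt] at h3 h4
  obtain rfl : j = m := by omega
  rw [linearPoly_eval]
  push_cast
  ring

/-- The simple module `M^{z-k}_{(k,∞)}` over `A(z-k)`, with support `{(z - j) | j > k}`: basis
`v_j`, `j > k`, with `X⁺ v_j = v_{j+1}` and `X⁻ v_j = (j - 1/2 - k) v_{j-1}`. -/
def simplePlus (k : halfIntegers) : WMod (linearPoly k) :=
  stringModule (linearPoly k) {j | (k : ℝ) < j} 1 (fun j => (j : ℂ) - 1 / 2 - (k : ℝ))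
    (fun j _ _ => by rw [linearPoly_eval, Pi.one_apply]; push_cast; ring)
    (fun j h => by
      rcases h with ⟨h1, h2⟩ | ⟨h1, h2⟩
      · rw [Set.mem_ofPred_eq] at h1 h2
        push_cast at h2
        linarith
      · exact linearPoly_eval_eq_zero (not_lt.1 h1) (le_of_lt h2))

/-- The simple module `M^{z-k}_{(-∞,k)}` over `A(z-k)`, with support `{(z - j) | j < k}`: basis
`v_j`, `j < k`, with `X⁺ v_j = (j + 1/2 - k) v_{j+1}` and `X⁻ v_j = v_{j-1}`. -/
def simpleMinus (k : halfIntegers) : WMod (linearPoly k) :=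
  stringModule (linearPoly k) {j | (j : ℝ) < k} (fun j => (j : ℂ) + 1 / 2 - (k : ℝ)) 1
    (fun j _ _ => by rw [linearPoly_eval, Pi.one_apply]; ring)
    (fun j h => by
      rcases h with ⟨h1, h2⟩ | ⟨h1, h2⟩
      · exact linearPoly_eval_eq_zero (le_of_lt h1) (not_lt.1 h2)
      · rw [Set.mem_ofPred_eq] at h1 h2
        push_cast at h2
        linarith)

/-- The non-simple indecomposable module `M^{z-k}_{ℝ_k^+}` over `A(z-k)` with support
`{(z - j) | j ∈ ℤ}` on which `X⁺` acts injectively and `X⁻ v_{k+1/2} = 0`: basis `v_j`, `j ∈ ℤ`,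
with `X⁺ v_j = v_{j+1}` and `X⁻ v_j = (j - 1/2 - k) v_{j-1}`. -/
def nonsimplePlus (k : halfIntegers) : WMod (linearPoly k) :=
  stringModule (linearPoly k) Set.univ 1 (fun j => (j : ℂ) - 1 / 2 - (k : ℝ))
    (fun j _ _ => by rw [linearPoly_eval, Pi.one_apply]; push_cast; ring)
    (fun _ h => by simp at h)

/-- The non-simple indecomposable module `M^{z-k}_{ℝ_k^-}` over `A(z-k)` with support
`{(z - j) | j ∈ ℤ}` on which `X⁻` acts injectively and `X⁺ v_{k-1/2} = 0`: basis `v_j`, `j ∈ ℤ`,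
with `X⁺ v_j = (j + 1/2 - k) v_{j+1}` and `X⁻ v_j = v_{j-1}`. -/
def nonsimpleMinus (k : halfIntegers) : WMod (linearPoly k) :=
  stringModule (linearPoly k) Set.univ (fun j => (j : ℂ) + 1 / 2 - (k : ℝ)) 1
    (fun j _ _ => by rw [linearPoly_eval, Pi.one_apply]; ring)
    (fun _ h => by simp at h)

/-- The monoid of all monic polynomials whose zero set is contained in `Z`. -/
def monicWithZerosIn (Z : Set halfIntegers) : Submonoid ℂ[X] where
  carrier := {t | t.Monic ∧ ∀ w : ℂ, t.IsRoot w → ∃ k ∈ Z, w = ((k : ℝ) : ℂ)}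
  one_mem' := ⟨Polynomial.monic_one, fun w h => by simp at h⟩
  mul_mem' := by
    rintro s t ⟨hs, hs'⟩ ⟨ht, ht'⟩
    refine ⟨hs.mul ht, fun w h => ?_⟩
    rcases Polynomial.root_mul.1 h with h | h
    exacts [hs' w h, ht' w h]

theorem linearPoly_mem {Z : Set halfIntegers} (k : Z) :
    linearPoly (k : halfIntegers) ∈ monicWithZerosIn Z :=
  ⟨Polynomial.monic_X_sub_C _, fun w h => ⟨k, k.2, by
    rw [Polynomial.IsRoot.def, linearPoly_eval, sub_eq_zero] at h
    exact h⟩⟩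

/-- `z - k` as an element of the monoid. -/
def degreeOf {Z : Set halfIntegers} (k : Z) : monicWithZerosIn Z :=
  ⟨linearPoly (k : halfIntegers), linearPoly_mem k⟩

open GrothendieckAlgebra

/-- `x_k^+ = [M^{z-k}_{(k,∞)}]`, in `𝒜(Γ,𝒪)` and in `𝒜^split(Γ,𝒪)`. -/
def xPlus (κ : Kind) {Z : Set halfIntegers} (k : Z) :
    GrothendieckAlgebra κ (monicWithZerosIn Z) :=
  cls κ (degreeOf k) (simplePlus k)

/-- `x_k^- = [M^{z-k}_{(-∞,k)}]`, in `𝒜(Γ,𝒪)` and in `𝒜^split(Γ,𝒪)`. -/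
def xMinus (κ : Kind) {Z : Set halfIntegers} (k : Z) :
    GrothendieckAlgebra κ (monicWithZerosIn Z) :=
  cls κ (degreeOf k) (simpleMinus k)

/-- `y_k^+ = [M^{z-k}_{ℝ_k^+}]`, in `𝒜^split(Γ,𝒪)`. -/
def yPlus {Z : Set halfIntegers} (k : Z) :
    GrothendieckAlgebra Kind.split (monicWithZerosIn Z) :=
  cls Kind.split (degreeOf k) (nonsimplePlus k)

/-- `y_k^- = [M^{z-k}_{ℝ_k^-}]`, in `𝒜^split(Γ,𝒪)`. -/
def yMinus {Z : Set halfIntegers} (k : Z) :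
    GrothendieckAlgebra Kind.split (monicWithZerosIn Z) :=
  cls Kind.split (degreeOf k) (nonsimpleMinus k)

end generators

end

end WeylTower

/-! The canonical map is the identity on classes of modules, and classes span both algebras. Both
products come from the same tensor product of modules and both units from the same module, so
multiplicativity and unitality need only be compared on classes (`canonicalMap_cls`,
`canonicalMap_mul`, `canonicalMap_one`). Surjectivity is immediate for the same reason, and the
values at `x_k^±` are instances of `canonicalMap_cls`.

The content lies in the values at `y_k^±`, which come from two short exact sequences over `A(z-k)`.
In `M_{ℝ_k^+}` the operator `X⁻` kills the first basis vector to the right of `k`, so the vectors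
with `j > k` span a submodule, with the same structure constants as `M_{(k,∞)}`. The quotient has
basis `v_j`, `j < k`, but carries the wrong normalisation: there `X⁺` has coefficient `1` and `X⁻`
has the linear coefficient, while in `M_{(-∞,k)}` the roles are exchanged. The linear coefficients
between two indices on the same side of `k` do not vanish, so a diagonal rescaling of the basis
identifies the two; it solves a first order recursion and involves factorials. The case of
`M_{ℝ_k^-}` is its mirror image, with `M_{(-∞,k)}` as submodule.

All maps involved are diagonal in the bases `v_j`. Hence `diagHom` and `isExt_stringModule` reduce
linearity and exactness to identities between coefficients at single indices, and
`isExt_nonsimplePlus` and `isExt_nonsimpleMinus` supply the rescalings. -/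

namespace WeylTower

noncomputable section

/-! ### Diagonal maps between string modules -/

section stringMaps

variable {S T : Set ℤ} {t : ℂ[X]}

open Classical in
/-- The coefficient of `v_j`, which is `0` if `j ∉ S`. -/
def StringSpace.coord (j : ℤ) : StringSpace S →+ ℂ where
  toFun v := if h : j ∈ S then (show S →₀ ℂ from v) ⟨j, h⟩ else 0
  map_zero' := by split_ifs <;> rfl
  map_add' v w := by
    split_ifs
    · rfl
    · exact (add_zero 0).symm

theorem StringSpace.coord_of_mem {j : ℤ} (h : j ∈ S) (v : StringSpace S) :
    StringSpace.coord j v = (show S →₀ ℂ from v) ⟨j, h⟩ := dif_pos h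

theorem StringSpace.coord_of_notMem {j : ℤ} (h : j ∉ S) (v : StringSpace S) :
    StringSpace.coord j v = 0 := dif_neg h

/-- Coordinates indexed by all of `ℤ` replace those indexed by the subtype `S`, so that shifting an
index needs no membership proof. -/
theorem StringSpace.ext_coord {v w : StringSpace S}
    (h : ∀ j ∈ S, StringSpace.coord j v = StringSpace.coord j w) : v = w := by
  refine Finsupp.ext fun j => ?_
  have := h j j.2
  rwa [StringSpace.coord_of_mem j.2, StringSpace.coord_of_mem j.2] at this

open Classical in
theorem StringSpace.coord_single (i : ℤ) (j : S) (c : ℂ) :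
    StringSpace.coord i (StringSpace.single j c) = if i = j then c else 0 := by
  by_cases h : i ∈ S
  · rw [StringSpace.coord_of_mem h]
    change Finsupp.single j c ⟨i, h⟩ = _
    rw [Finsupp.single_apply]
    refine if_congr ?_ rfl rfl
    rw [Subtype.ext_iff]
    exact eq_comm
  · rw [StringSpace.coord_of_notMem h, if_neg]
    rintro rfl
    exact h j.2

theorem StringSpace.coord_smul (r : ℂ[X]) (j : ℤ) (v : StringSpace S) :
    StringSpace.coord j (r • v) = r.eval (j : ℂ) * StringSpace.coord j v := by
  classical
  induction v using StringSpace.induction with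
  | h0 => rw [smul_zero, map_zero, mul_zero]
  | hs i c =>
    rw [StringSpace.smul_single, StringSpace.coord_single, StringSpace.coord_single]
    split_ifs with h
    · rw [h]
    · rw [mul_zero]
  | hadd v w hv hw => rw [smul_add, map_add, map_add, hv, hw, mul_add]

-- Only the target index has to be tested for membership in `S`: if the source index `j - d` lies
-- outside `S`, its coordinate is already `0` by convention.
open Classical in
theorem coord_stepAddHom (d : ℤ) (a : ℤ → ℂ) (j : ℤ) (v : StringSpace S) :
    StringSpace.coord j (stepAddHom S d a v) =
      if j ∈ S then a (j - d) * StringSpace.coord (j - d) v else 0 := by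
  by_cases hj : j ∈ S
  swap
  · rw [StringSpace.coord_of_notMem hj, if_neg hj]
  rw [if_pos hj]
  induction v using StringSpace.induction with
  | h0 => rw [map_zero, map_zero, map_zero, mul_zero]
  | hs i c =>
    rw [StringSpace.coord_single]
    by_cases h : (i : ℤ) + d ∈ S
    · rw [stepAddHom_single_mem h, StringSpace.coord_single]
      by_cases e : j = (i : ℤ) + d
      · rw [if_pos e, if_pos (by omega), e, add_sub_cancel_right]
      · rw [if_neg e, if_neg (by omega), mul_zero]
    · rw [stepAddHom_single_notMem h, map_zero, if_neg, mul_zero]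
      intro e
      exact h (by rwa [← e, sub_add_cancel])
  | hadd v w hv hw => rw [map_add, map_add, map_add, hv, hw, mul_add]

open Classical in
/-- The additive map with `v_j ↦ c_j v_j`, where `v_j` on the right means `0` if `j ∉ T`. -/
def diagHom (S T : Set ℤ) (c : ℤ → ℂ) : StringSpace S →+ StringSpace T :=
  StringSpace.lift fun j : S =>
    if h : (j : ℤ) ∈ T then
      (StringSpace.singleHom (⟨j, h⟩ : T)).comp (AddMonoidHom.mulLeft (c j))
    else 0

open Classical in
theorem coord_diagHom (c : ℤ → ℂ) (j : ℤ) (v : StringSpace S) :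
    StringSpace.coord j (diagHom S T c v) =
      if j ∈ T then c j * StringSpace.coord j v else 0 := by
  by_cases hj : j ∈ T
  swap
  · rw [StringSpace.coord_of_notMem hj, if_neg hj]
  rw [if_pos hj]
  induction v using StringSpace.induction with
  | h0 => rw [map_zero, map_zero, map_zero, mul_zero]
  | hs i x =>
    rw [StringSpace.coord_single]
    unfold diagHom
    rw [StringSpace.lift_single]
    by_cases h : (i : ℤ) ∈ T
    · rw [dif_pos h]
      change StringSpace.coord j (StringSpace.single _ (c i * x)) = _
      rw [StringSpace.coord_single]
      by_cases e : j = i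
      · rw [if_pos e, if_pos e, e]
      · rw [if_neg e, if_neg e, mul_zero]
    · rw [dif_neg h, AddMonoidHom.zero_apply, map_zero, if_neg, mul_zero]
      rintro rfl
      exact h hj
  | hadd v w hv hw => rw [map_add, map_add, map_add, hv, hw, mul_add]

/-- A diagonal map preserves the index, and `r` acts on the line of index `j` in both spaces by the
same scalar `r(j)`. -/
theorem diagHom_smul (c : ℤ → ℂ) (r : ℂ[X]) (v : StringSpace S) :
    diagHom S T c (r • v) = r • diagHom S T c v := by
  refine StringSpace.ext_coord fun j hj => ?_
  rw [coord_diagHom, StringSpace.coord_smul, StringSpace.coord_smul, coord_diagHom, if_pos hj,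
    if_pos hj]
  ring

-- The hypothesis compares the coefficients of `v_{j+d}` in the two images of `v_j`. On the left the
-- vector may die because `j + d` leaves `S`, on the right because `j` is not in `T`; the two tests
-- record this.
open Classical in
theorem diagHom_stepAddHom (d : ℤ) {a a' c : ℤ → ℂ}
    (h : ∀ j ∈ S, j + d ∈ T →
      (if j + d ∈ S then c (j + d) * a j else 0) = if j ∈ T then a' j * c j else 0)
    (v : StringSpace S) :
    diagHom S T c (stepAddHom S d a v) = stepAddHom T d a' (diagHom S T c v) := by
  refine StringSpace.ext_coord fun j hj => ?_
  rw [coord_diagHom, coord_stepAddHom, coord_stepAddHom, coord_diagHom, if_pos hj, if_pos hj]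
  by_cases hS : j - d ∈ S
  · have := h (j - d) hS (by rwa [sub_add_cancel])
    rw [sub_add_cancel] at this
    have h2 := congrArg (fun x => x * StringSpace.coord (j - d) v) this
    simp only [ite_mul, zero_mul] at h2
    rw [mul_ite, mul_ite, mul_zero, mul_zero, ← mul_assoc, ← mul_assoc]
    exact h2
  -- Nothing in `v` maps to index `j`, so both sides vanish.
  · rw [StringSpace.coord_of_notMem hS v]
    simp

open Classical in
/-- A diagonal map between string modules which intertwines `X⁺` and `X⁻` on basis vectors is
`A(t)`-linear. -/
theorem exists_linearMap_diagHom {a b a' b' : ℤ → ℂ}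
    (hin : ∀ j, j ∈ S → j + 1 ∈ S → a j * b (j + 1) = t.eval ((j : ℂ) + 1 / 2))
    (hout : ∀ j, (j ∈ S ∧ j + 1 ∉ S ∨ j ∉ S ∧ j + 1 ∈ S) → t.eval ((j : ℂ) + 1 / 2) = 0)
    (hin' : ∀ j, j ∈ T → j + 1 ∈ T → a' j * b' (j + 1) = t.eval ((j : ℂ) + 1 / 2))
    (hout' : ∀ j, (j ∈ T ∧ j + 1 ∉ T ∨ j ∉ T ∧ j + 1 ∈ T) → t.eval ((j : ℂ) + 1 / 2) = 0)
    (c : ℤ → ℂ)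
    (hup : ∀ j ∈ S, j + 1 ∈ T →
      (if j + 1 ∈ S then c (j + 1) * a j else 0) = if j ∈ T then a' j * c j else 0)
    (hdown : ∀ j ∈ S, j + (-1) ∈ T →
      (if j + (-1) ∈ S then c (j + (-1)) * b j else 0) = if j ∈ T then b' j * c j else 0) :
    ∃ f : stringModule t S a b hin hout →ₗ[A t] stringModule t T a' b' hin' hout',
      ∀ v : StringSpace S, f v = diagHom S T c v := by
  -- By `map_smul_of_generators` only `R`, `X⁺` and `X⁻` have to be checked. The first is automatic
  -- for a diagonal map; `hup` and `hdown` are the other two.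
  refine ⟨{ diagHom S T c with
    map_smul' := map_smul_of_generators (M := stringModule t S a b hin hout)
      (B := stringModule t T a' b' hin' hout') (diagHom S T c) ?_ ?_ ?_ }, fun v => rfl⟩
  · intro r v
    rw [WMod.coeff_smul]
    exact diagHom_smul c r v
  · intro v
    refine (congrArg (diagHom S T c) (stringModule_up hin hout v)).trans ?_
    refine Eq.trans ?_ (stringModule_up hin' hout' (diagHom S T c v)).symm
    exact diagHom_stepAddHom 1 hup v
  · intro v
    refine (congrArg (diagHom S T c) (stringModule_down hin hout v)).trans ?_
    refine Eq.trans ?_ (stringModule_down hin' hout' (diagHom S T c v)).symm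
    exact diagHom_stepAddHom (-1) hdown v

theorem diagHom_injective (hST : S ⊆ T) {c : ℤ → ℂ} (hc : ∀ j ∈ S, c j ≠ 0) :
    Function.Injective (diagHom S T c) := by
  intro v w h
  refine StringSpace.ext_coord fun j hj => ?_
  have := congrArg (StringSpace.coord j) h
  rw [coord_diagHom, coord_diagHom, if_pos (hST hj), if_pos (hST hj)] at this
  exact mul_left_cancel₀ (hc j hj) this

theorem diagHom_surjective (hTS : T ⊆ S) {c : ℤ → ℂ} (hc : ∀ j ∈ T, c j ≠ 0) :
    Function.Surjective (diagHom S T c) := by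
  intro v
  -- The pointwise inverse of `c` gives a preimage; it is only used at indices in `T`, where `c`
  -- does not vanish.
  refine ⟨diagHom T S c⁻¹ v, StringSpace.ext_coord fun j hj => ?_⟩
  rw [coord_diagHom, coord_diagHom, if_pos hj, if_pos (hTS hj), Pi.inv_apply,
    mul_inv_cancel_left₀ (hc j hj)]

/-- Both the image of the first map and the kernel of the second consist of the vectors supported on
`S`, since `c` and `d` are invertible where they matter and `T` is the complement of `S` in `U`. -/
theorem diagHom_exact {U : Set ℤ} (hTU : T ⊆ U) (h : ∀ j ∈ U, j ∈ T ↔ j ∉ S)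
    {c d : ℤ → ℂ} (hc : ∀ j ∈ S, c j ≠ 0) (hd : ∀ j ∈ T, d j ≠ 0) :
    Function.Exact (diagHom S U c) (diagHom U T d) := by
  intro v
  constructor
  · intro hv
    refine ⟨diagHom U S c⁻¹ v, StringSpace.ext_coord fun j hj => ?_⟩
    rw [coord_diagHom, coord_diagHom, if_pos hj]
    by_cases hjS : j ∈ S
    · rw [if_pos hjS, Pi.inv_apply, mul_inv_cancel_left₀ (hc j hjS)]
    -- Off `S` the preimage contributes nothing, so the coordinate of `v` must vanish: it does
    -- because `v` is killed by the second map and `d j ≠ 0`.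
    · have hjT := (h j hj).2 hjS
      have := congrArg (StringSpace.coord j) hv
      rw [coord_diagHom, if_pos hjT, map_zero] at this
      rw [if_neg hjS, mul_zero, (mul_eq_zero.1 this).resolve_left (hd j hjT)]
  · rintro ⟨w, rfl⟩
    refine StringSpace.ext_coord fun j hj => ?_
    rw [coord_diagHom, coord_diagHom, if_pos hj, if_pos (hTU hj),
      StringSpace.coord_of_notMem ((h j (hTU hj)).1 hj), mul_zero, mul_zero, map_zero]

open Classical in
/-- If `U` is the disjoint union of `S` and `T`, and the obvious maps rescaled by `c` and `d`
commute with `X⁺` and `X⁻`, then the string module on `U` is an extension of the one on `T` by the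
one on `S`. -/
theorem isExt_stringModule {U : Set ℤ} {a b a' b' a'' b'' : ℤ → ℂ}
    (hin : ∀ j, j ∈ S → j + 1 ∈ S → a j * b (j + 1) = t.eval ((j : ℂ) + 1 / 2))
    (hout : ∀ j, (j ∈ S ∧ j + 1 ∉ S ∨ j ∉ S ∧ j + 1 ∈ S) → t.eval ((j : ℂ) + 1 / 2) = 0)
    (hin' : ∀ j, j ∈ U → j + 1 ∈ U → a' j * b' (j + 1) = t.eval ((j : ℂ) + 1 / 2))
    (hout' : ∀ j, (j ∈ U ∧ j + 1 ∉ U ∨ j ∉ U ∧ j + 1 ∈ U) → t.eval ((j : ℂ) + 1 / 2) = 0)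
    (hin'' : ∀ j, j ∈ T → j + 1 ∈ T → a'' j * b'' (j + 1) = t.eval ((j : ℂ) + 1 / 2))
    (hout'' : ∀ j, (j ∈ T ∧ j + 1 ∉ T ∨ j ∉ T ∧ j + 1 ∈ T) → t.eval ((j : ℂ) + 1 / 2) = 0)
    (hSU : S ⊆ U) (hTU : T ⊆ U) (h : ∀ j ∈ U, j ∈ T ↔ j ∉ S) (c d : ℤ → ℂ)
    (hc : ∀ j ∈ S, c j ≠ 0) (hd : ∀ j ∈ T, d j ≠ 0)
    (hcup : ∀ j ∈ S, j + 1 ∈ U →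
      (if j + 1 ∈ S then c (j + 1) * a j else 0) = if j ∈ U then a' j * c j else 0)
    (hcdown : ∀ j ∈ S, j + (-1) ∈ U →
      (if j + (-1) ∈ S then c (j + (-1)) * b j else 0) = if j ∈ U then b' j * c j else 0)
    (hdup : ∀ j ∈ U, j + 1 ∈ T →
      (if j + 1 ∈ U then d (j + 1) * a' j else 0) = if j ∈ T then a'' j * d j else 0)
    (hddown : ∀ j ∈ U, j + (-1) ∈ T →
      (if j + (-1) ∈ U then d (j + (-1)) * b' j else 0) = if j ∈ T then b'' j * d j else 0) :
    IsExt Kind.ordinary (stringModule t S a b hin hout) (stringModule t U a' b' hin' hout')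
      (stringModule t T a'' b'' hin'' hout'') := by
  obtain ⟨f, hf⟩ := exists_linearMap_diagHom hin hout hin' hout' c hcup hcdown
  obtain ⟨g, hg⟩ := exists_linearMap_diagHom hin' hout' hin'' hout'' d hdup hddown
  -- Injectivity, exactness and surjectivity depend only on the underlying functions, so they
  -- transfer from the diagonal maps.
  have ef : (f : StringSpace S → StringSpace U) = diagHom S U c := funext hf
  have eg : (g : StringSpace U → StringSpace T) = diagHom U T d := funext hg
  refine ⟨f, g, ?_, ?_, ?_⟩
  · exact ef ▸ diagHom_injective hSU hc
  · have := diagHom_exact hTU h hc hd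
    rw [← ef, ← eg] at this
    exact this
  · exact eg ▸ diagHom_surjective hTU hd

end stringMaps

/-! ### The two extensions with middle terms `M_{ℝ_k^±}` -/

section extensions

/-- Writing `k = m + 1/2` turns the real conditions `j < k` and `j > k` into `j ≤ m` and `j > m`,
which integer arithmetic can decide. -/
theorem intCast_lt_add_half {j m : ℤ} : (j : ℝ) < m + 1 / 2 ↔ j ≤ m := by
  constructor
  · intro h
    by_contra! h'
    have : (m : ℝ) + 1 ≤ j := by exact_mod_cast Int.add_one_le_of_lt h'
    linarith
  · intro h
    have : (j : ℝ) ≤ m := by exact_mod_cast h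
    linarith

theorem add_half_lt_intCast {j m : ℤ} : (m + 1 / 2 : ℝ) < j ↔ m < j := by
  constructor
  · intro h
    by_contra! h'
    have : (j : ℝ) ≤ m := by exact_mod_cast h'
    linarith
  · intro h
    have : (m : ℝ) + 1 ≤ j := by exact_mod_cast Int.add_one_le_of_lt h
    linarith

/-- `0 → M_{(k,∞)} → M_{ℝ_k^+} → M_{(-∞,k)} → 0` -/
theorem isExt_nonsimplePlus (k : halfIntegers) :
    IsExt Kind.ordinary (simplePlus k) (nonsimplePlus k) (simpleMinus k) := by
  obtain ⟨k, m, rfl⟩ := k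
  -- With `k = m + 1/2`, the quotient map `v_j ↦ d_j v_j` commutes with `X⁺` exactly when `d_{j+1} =
  -- (j - m) d_j` for `j + 1 ≤ m`. Starting from `d_m = 1` this forces `d_{m-n} = (-1)^n / n!`. For
  -- `j > m` the truncation gives the value `1`, which plays no role.
  let d : ℤ → ℂ := fun j => (-1) ^ (m - j).toNat / ((m - j).toNat.factorial : ℂ)
  have key : ∀ j : ℤ, j + 1 ≤ m → d (j + 1) = ((j : ℂ) - m) * d j := fun j hj => by
    obtain ⟨n, rfl⟩ : ∃ n : ℕ, j = m - (n + 1) := ⟨(m - 1 - j).toNat, by omega⟩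
    have h1 : (m - (m - ((n : ℤ) + 1) + 1)).toNat = n := by omega
    have h2 : (m - (m - ((n : ℤ) + 1))).toNat = n + 1 := by omega
    simp only [d, h1, h2]
    rw [Nat.factorial_succ]
    have h3 : (n.factorial : ℂ) ≠ 0 := Nat.cast_ne_zero.2 n.factorial_ne_zero
    have h4 : (n : ℂ) + 1 ≠ 0 := Nat.cast_add_one_ne_zero n
    push_cast
    field_simp
    ring
  -- The submodule has the same structure constants as the whole module, so its inclusion needs no
  -- rescaling: `c = 1`.
  refine isExt_stringModule _ _ _ _ _ _ (Set.subset_univ _) (Set.subset_univ _) (fun j _ => ?_)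
    1 d (fun _ _ => one_ne_zero) (fun j _ => div_ne_zero (pow_ne_zero _ (by norm_num))
      (Nat.cast_ne_zero.2 (Nat.factorial_ne_zero _))) ?_ ?_ ?_ ?_
  · simp only [Set.mem_ofPred_eq, intCast_lt_add_half, add_half_lt_intCast, not_lt]
  · intro j hj _
    simp only [Set.mem_ofPred_eq, add_half_lt_intCast, Set.mem_univ, if_true] at hj ⊢
    rw [if_pos (by omega)]
    simp
  · intro j hj _
    simp only [Set.mem_ofPred_eq, add_half_lt_intCast, Set.mem_univ, if_true] at hj ⊢
    split_ifs with h
    · simp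
    -- The lowest vector of the submodule: `X⁻` would leave it, but its coefficient `j - 1/2 - k` is
    -- `0` here.
    · obtain rfl : j = m + 1 := by omega
      push_cast
      simp only [Pi.one_apply]
      ring
  · intro j _ hj
    simp only [Set.mem_ofPred_eq, intCast_lt_add_half, Set.mem_univ, if_true] at hj ⊢
    rw [if_pos (by omega), key j hj]
    push_cast
    simp only [Pi.one_apply]
    ring
  · intro j _ hj
    simp only [Set.mem_ofPred_eq, intCast_lt_add_half, Set.mem_univ, if_true] at hj ⊢
    -- In this form the condition for `X⁻` is the recursion `key` at `j - 1`, so the `d` chosen for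
    -- `X⁺` serves for `X⁻` as well.
    have hc : (j : ℂ) - 1 / 2 - ((((m : ℝ) + 1 / 2 : ℝ)) : ℂ) = ((j + (-1) : ℤ) : ℂ) - m := by
      push_cast; ring
    rw [hc]
    split_ifs with h
    · have := key (j + (-1)) (by omega)
      rw [neg_add_cancel_right] at this
      rw [this]
      simp only [Pi.one_apply]
      ring
    -- Here `v_j` maps to `0` in the quotient, and `X⁻ v_j = 0` already in the middle term.
    · obtain rfl : j = m + 1 := by omega
      push_cast
      ring

/-- `0 → M_{(-∞,k)} → M_{ℝ_k^-} → M_{(k,∞)} → 0` -/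
theorem isExt_nonsimpleMinus (k : halfIntegers) :
    IsExt Kind.ordinary (simpleMinus k) (nonsimpleMinus k) (simplePlus k) := by
  obtain ⟨k, m, rfl⟩ := k
  -- Now the linear coefficient belongs to `X⁺` in the middle term, so the recursion is `d_j = (j -
  -- m) d_{j+1}` for `j ≥ m + 1`. From `d_{m+1} = 1` one gets `d_{m+1+n} = 1 / n!`; there is no sign
  -- since the factors are positive.
  let d : ℤ → ℂ := fun j => ((j - m - 1).toNat.factorial : ℂ)⁻¹
  have key : ∀ j : ℤ, m + 1 ≤ j → d j = ((j : ℂ) - m) * d (j + 1) := fun j hj => by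
    obtain ⟨n, rfl⟩ : ∃ n : ℕ, j = m + 1 + n := ⟨(j - (m + 1)).toNat, by omega⟩
    have h1 : (m + 1 + (n : ℤ) - m - 1).toNat = n := by omega
    have h2 : (m + 1 + (n : ℤ) + 1 - m - 1).toNat = n + 1 := by omega
    simp only [d, h1, h2]
    rw [Nat.factorial_succ]
    have h3 : (n.factorial : ℂ) ≠ 0 := Nat.cast_ne_zero.2 n.factorial_ne_zero
    have h4 : (n : ℂ) + 1 ≠ 0 := Nat.cast_add_one_ne_zero n
    push_cast
    field_simp
    ring
  refine isExt_stringModule _ _ _ _ _ _ (Set.subset_univ _) (Set.subset_univ _) (fun j _ => ?_)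
    1 d (fun _ _ => one_ne_zero) (fun j _ => inv_ne_zero
      (Nat.cast_ne_zero.2 (Nat.factorial_ne_zero _))) ?_ ?_ ?_ ?_
  · simp only [Set.mem_ofPred_eq, intCast_lt_add_half, add_half_lt_intCast, not_le]
  · intro j hj _
    simp only [Set.mem_ofPred_eq, intCast_lt_add_half, Set.mem_univ, if_true] at hj ⊢
    split_ifs with h
    · simp
    -- The highest vector of the submodule: the coefficient `j + 1/2 - k` of `X⁺` vanishes, so `X⁺`
    -- does not lead out of it.
    · obtain rfl : j = m := by omega
      push_cast
      simp only [Pi.one_apply]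
      ring
  · intro j hj _
    simp only [Set.mem_ofPred_eq, intCast_lt_add_half, Set.mem_univ, if_true] at hj ⊢
    rw [if_pos (by omega)]
    simp
  · intro j _ hj
    simp only [Set.mem_ofPred_eq, add_half_lt_intCast, Set.mem_univ, if_true] at hj ⊢
    have hc : (j : ℂ) + 1 / 2 - ((((m : ℝ) + 1 / 2 : ℝ)) : ℂ) = (j : ℂ) - m := by
      push_cast; ring
    rw [hc]
    split_ifs with h
    · rw [key j h]
      simp only [Pi.one_apply]
      ring
    -- The vector `v_m` dies in the quotient, consistently with `X⁺ v_m = 0`.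
    · obtain rfl : j = m := by omega
      ring
  · intro j _ hj
    simp only [Set.mem_ofPred_eq, add_half_lt_intCast, Set.mem_univ, if_true] at hj ⊢
    -- No boundary case arises: if `j - 1` lies to the right of `k`, so does `j`. The condition for
    -- `X⁻` is again the recursion, shifted by one.
    rw [if_pos (by omega), key (j + (-1)) (by omega), neg_add_cancel_right]
    push_cast
    simp only [Pi.one_apply]
    ring

end extensions

/-! ### The canonical map as an algebra homomorphism -/

namespace GrothendieckAlgebra

variable {Γ : Submonoid ℂ[X]}

/-- On the summand of degree `t` the map is the base change of `K0.canonical`, applied here to `1 ⊗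
[M]`. Since classes span, this formula determines the map. -/
theorem canonicalMap_cls (t : Γ) (M : WMod (t : ℂ[X])) :
    canonicalMap Γ (cls Kind.split t M) = cls Kind.ordinary t M := by
  classical
  unfold canonicalMap cls incl
  refine (DirectSum.lmap_lof _ t _).trans ?_
  rw [LinearMap.baseChange_tmul]
  congr 2

theorem canonicalMap_one : canonicalMap Γ 1 = 1 := canonicalMap_cls 1 unitModule

/-- Both sides are bilinear, which reduces the claim to two classes; there each side is the class of
the same tensor product. -/
theorem canonicalMap_mul (x y : GrothendieckAlgebra Kind.split Γ) :
    canonicalMap Γ (x * y) = canonicalMap Γ x * canonicalMap Γ y := by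
  induction x using induction with
  | hsmul c x hx => rw [smul_mul_assoc, map_smul, hx, map_smul, smul_mul_assoc]
  | hadd x x' hx hx' => rw [add_mul, map_add, hx, hx', map_add, add_mul]
  | hcls s M =>
    induction y using induction with
    | hsmul c x hx => rw [mul_smul_comm, map_smul, hx, map_smul, mul_smul_comm]
    | hadd x x' hx hx' => rw [mul_add, map_add, hx, hx', map_add, mul_add]
    | hcls t N => rw [cls_mul_cls, canonicalMap_cls, canonicalMap_cls, canonicalMap_cls, cls_mul_cls]

theorem canonicalMap_surjective : Function.Surjective (canonicalMap Γ) := by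
  intro x
  induction x using induction with
  | hsmul c x hx =>
    obtain ⟨y, rfl⟩ := hx
    exact ⟨c • y, map_smul _ _ _⟩
  | hadd x x' hx hx' =>
    obtain ⟨y, rfl⟩ := hx
    obtain ⟨y', rfl⟩ := hx'
    exact ⟨y + y', map_add _ _ _⟩
  | hcls t M => exact ⟨_, canonicalMap_cls t M⟩

/-- This carries the defining relation of the Grothendieck group into the graded algebra, where it
turns the two short exact sequences into the values at `y_k^±`. -/
theorem cls_ext {κ : Kind} {t : Γ} {M N Q : WMod (t : ℂ[X])} (h : IsExt κ M N Q) :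
    cls κ t N = cls κ t M + cls κ t Q := by
  unfold cls
  rw [K0.mk_ext h, TensorProduct.tmul_add, map_add]

end GrothendieckAlgebra

end

end WeylTower

/-! ### The theorem -/

theorem mainTheorem7 (Z : Set WeylTower.halfIntegers) :
    ∃ φ : WeylTower.GrothendieckAlgebra WeylTower.Kind.split (WeylTower.monicWithZerosIn Z) →ₐ[ℂ]
        WeylTower.GrothendieckAlgebra WeylTower.Kind.ordinary (WeylTower.monicWithZerosIn Z),
      φ.toLinearMap = WeylTower.GrothendieckAlgebra.canonicalMap (WeylTower.monicWithZerosIn Z) ∧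
      Function.Surjective φ ∧
      ∀ k : Z,
        φ (WeylTower.xPlus WeylTower.Kind.split k) = WeylTower.xPlus WeylTower.Kind.ordinary k ∧
        φ (WeylTower.xMinus WeylTower.Kind.split k) = WeylTower.xMinus WeylTower.Kind.ordinary k ∧
        φ (WeylTower.yPlus k) = WeylTower.xPlus WeylTower.Kind.ordinary k +
          WeylTower.xMinus WeylTower.Kind.ordinary k ∧
        φ (WeylTower.yMinus k) = WeylTower.xPlus WeylTower.Kind.ordinary k +
          WeylTower.xMinus WeylTower.Kind.ordinary k := by
  open WeylTower GrothendieckAlgebra in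
  refine ⟨AlgHom.ofLinearMap (canonicalMap _) canonicalMap_one canonicalMap_mul,
    rfl, canonicalMap_surjective, fun k => ⟨canonicalMap_cls _ _, canonicalMap_cls _ _,
      (canonicalMap_cls _ _).trans (cls_ext (isExt_nonsimplePlus k)), ?_⟩⟩
  -- For `y_k^-` the submodule is `M_{(-∞,k)}`, so the exact sequence yields the summands in the
  -- order `x_k^- + x_k^+`.
  rw [add_comm]
  exact (canonicalMap_cls _ _).trans (cls_ext (isExt_nonsimpleMinus k))
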